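/- **Setting.** Let $X=(x_1,\dots,x_p)\in\mathbb R^{n\times p}$, $y\in\mathbb R^n$, $\beta^*\in\mathbb R^p$, $\lambda_0>0$ and $\xi>1$. The scaled lasso $(\hat\beta,\hat\sigma)$ is any joint minimizer over $\beta\in\mathbb R^p$, $\sigma\ge 0$ of $$L_{\lambda_0}(\beta,\sigma)=\frac{|y-X\beta|_2^2}{2n\sigma}+\frac{\sigma}{2}+\lambda_0|\beta|_1,$$ where at $\sigma=0$ the loss is $\lambda_0|\beta|_1$ if $y=X\beta$ and $+\infty$ otherwise. Put $\sigma^*=|y-X\beta^*|_2/n^{1/2}$ (assumed positive) and $z^*=|X'(y-X\beta^*)/n|_\infty/\sigma^*$. For $T\subset\{1,\dots,p\}$ let $$\kappa(\xi,T)=\inf\Big\{\frac{|T|^{1/2}|Xu|_2}{n^{1/2}|u_T|_1}:\ u\ne 0,\ |u_{T^c}|_1\le\xi|u_T|_1\Big\}$$ and $$\mu(\lambda,\xi)=(\xi+1)\min_T\inf_{0<\nu<1}\max\Big[\frac{|\beta^*_{T^c}|_1}{\nu},\ \frac{\lambda|T|/\{2(1-\nu)\}}{\kappa^2\{(\xi+\nu)/(1-\nu),T\}}\Big],$$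 the second entry of the maximum being $0$ for $T=\emptyset$ and $+\infty$ if $\lambda>0$, $T\neq\emptyset$ and $\kappa=0$. Set $\tau_*=\{\lambda_0\mu(\sigma^*\lambda_0,\xi)/\sigma^*\}^{1/2}$. Let $\mathrm{pr}_{\beta^*,\sigma}$ be the probability measure under which $y-X\beta^*\sim N(0,\sigma^2I_n)$, $\sigma>0$; whenever it is used, $|x_j|_2^2=n$ for all $j$. **Theorem 2.** (i) If $z^*\le(1-\tau_*^2)\lambda_0(\xi-1)/(\xi+1)$, then $$\max\Big(1-\frac{\hat\sigma}{\sigma^*},\,1-\frac{\sigma^*}{\hat\sigma}\Big)\le\tau_*^2,\qquad |\hat\beta-\beta^*|_1\le\frac{\mu(\sigma^*\lambda_0,\xi)}{1-\tau_*^2},$$ where the second inequality is asserted for $\tau_*<1$, in which case also $\hat\sigma>0$. (ii) Let $\epsilon>0$, and let $C$ denote the requirement $$\tau_*<1,\qquad \lambda_0\ge\frac{\{(2/n)\log(p/\epsilon)\}^{1/2}(\xi+1)}{(\xi-1)(1-\tau_*^2)},$$ which depends on $y$ through $\sigma^*$. If $n-2>\log(p/\epsilon)\to\infty$, then $$\mathrm{pr}_{\beta^*,\sigma}\Big\{C\text{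 fails or } z^*\le(1-\tau_*^2)\lambda_0\frac{\xi-1}{\xi+1}\Big\}\ \ge\ 1-\{1+o(1)\}\frac{\epsilon}{\{\pi\log(p/\epsilon)\}^{1/2}};$$ in particular, if $C$ holds almost surely, then $$\mathrm{pr}_{\beta^*,\sigma}\Big\{z^*\le(1-\tau_*^2)\lambda_0\frac{\xi-1}{\xi+1}\Big\}\ \ge\ 1-\{1+o(1)\}\frac{\epsilon}{\{\pi\log(p/\epsilon)\}^{1/2}}.$$ The $o(1)$ tends to $0$ as $\log(p/\epsilon)\to\infty$, uniformly in $n>\log(p/\epsilon)+2$ and in all other parameters. (iii) Fix $\xi>1$ and $A>(\xi+1)/(\xi-1)$. For $n=1,2,\dots$ let $p$, $X$, $\beta^*$ and $\sigma>0$ depend on $n$, let $\lambda_0=A\{(2/n)\log p\}^{1/2}$ (this is $0$ if $p\le1$), and let $(\hat\beta,\hat\sigma)$ be a scaled lasso estimator with $\hat\sigma$ measurable. If $\lambda_0\mu(\sigma\lambda_0,\xi)/\sigma=o(n^{-1/2})$ as $n\to\infty$, then $$n^{1/2}(\hat\sigma/\sigma-1)\to N(0,1/2)\quad\text{in distribution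 under }\mathrm{pr}_{\beta^*,\sigma}.$$ -/

import Mathlib

open MeasureTheory ProbabilityTheory Filter Topology Matrix Asymptotics
open scoped ENNReal NNReal

noncomputable section

namespace ScaledLasso

variable {n p : ℕ}

/-- The Euclidean norm `|v|₂`. -/
def l2 {m : ℕ} (v : Fin m → ℝ) : ℝ := √(∑ i, v i ^ 2)

/-- The norm `|v_T|₁ = ∑_{j ∈ T} |v_j|`. -/
def l1On {m : ℕ} (T : Finset (Fin m)) (v : Fin m → ℝ) : ℝ := ∑ j ∈ T, |v j|

/-- The norm `|v|₁`. -/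
def l1 {m : ℕ} (v : Fin m → ℝ) : ℝ := ∑ j, |v j|

/-- The penalized joint loss `|y - X b|₂² / (2 n s) + s / 2 + lam0 |b|₁`. -/
def jointLoss (X : Matrix (Fin n) (Fin p) ℝ) (y : Fin n → ℝ) (lam0 : ℝ)
    (b : Fin p → ℝ) (s : ℝ) : ℝ :=
  l2 (y - X *ᵥ b) ^ 2 / (2 * n * s) + s / 2 + lam0 * l1 b

/-- The effective domain of the joint loss. For `s > 0` there is no constraint on `b`; at `s = 0`
the lower semicontinuous convex extension of the loss is `lam0 |b|₁` if `y = X b` and `+∞`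
otherwise, so that `(b, 0)` belongs to the domain only if `y = X b`. -/
def Admissible (X : Matrix (Fin n) (Fin p) ℝ) (y : Fin n → ℝ)
    (b : Fin p → ℝ) (s : ℝ) : Prop :=
  0 ≤ s ∧ (s = 0 → y = X *ᵥ b)

/-- `(bhat, shat)` is a scaled lasso estimate: a joint minimizer of the penalized joint loss. -/
def IsScaledLasso (X : Matrix (Fin n) (Fin p) ℝ) (y : Fin n → ℝ) (lam0 : ℝ)
    (bhat : Fin p → ℝ) (shat : ℝ) : Prop :=
  Admissible X y bhat shat ∧
    ∀ b s, Admissible X y b s → jointLoss X y lam0 bhat shat ≤ jointLoss X y lam0 b s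

/-- The oracle noise level `σ* = |y - X β*|₂ / √n`. -/
def sigmaStar (X : Matrix (Fin n) (Fin p) ℝ) (y : Fin n → ℝ) (β : Fin p → ℝ) : ℝ :=
  l2 (y - X *ᵥ β) / √n

/-- `z* = |Xᵀ(y - X β*) / n|_∞ / σ*`; the norm on `Fin p → ℝ` is the maximum norm. -/
def zStar (X : Matrix (Fin n) (Fin p) ℝ) (y : Fin n → ℝ) (β : Fin p → ℝ) : ℝ :=
  ‖(n : ℝ)⁻¹ • (Xᵀ *ᵥ (y - X *ᵥ β))‖ / sigmaStar X y β

/-- The cone `{u : |u_{Tᶜ}|₁ ≤ ξ |u_T|₁}`. -/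
def cone (ξ : ℝ) (T : Finset (Fin p)) : Set (Fin p → ℝ) :=
  {u | l1On Tᶜ u ≤ ξ * l1On T u}

/-- The compatibility factor `κ(ξ, T)`, with value `∞` when the cone is trivial (`T = ∅`). -/
def compat (X : Matrix (Fin n) (Fin p) ℝ) (ξ : ℝ) (T : Finset (Fin p)) : ℝ≥0∞ :=
  ⨅ u ∈ {u | u ∈ cone ξ T ∧ u ≠ 0},
    ENNReal.ofReal (√(T.card : ℝ) * l2 (X *ᵥ u) / (√(n : ℝ) * l1On T u))

/-- The `ℓ₁` error bound `μ(lam, ξ)` as an extended nonnegative number: a vanishing compatibility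
factor of a nonempty `T` gives the value `∞` to the corresponding term. -/
def muExt (X : Matrix (Fin n) (Fin p) ℝ) (β : Fin p → ℝ) (lam ξ : ℝ) : ℝ≥0∞ :=
  ENNReal.ofReal (ξ + 1) *
    ⨅ T : Finset (Fin p), ⨅ ν ∈ Set.Ioo (0 : ℝ) 1,
      max (ENNReal.ofReal (l1On Tᶜ β / ν))
        (ENNReal.ofReal (lam * T.card / (2 * (1 - ν))) /
          compat X ((ξ + ν) / (1 - ν)) T ^ 2)

/-- `μ(lam, ξ)` is finite: take `T = ∅`. -/
theorem muExt_ne_top (X : Matrix (Fin n) (Fin p) ℝ) (β : Fin p → ℝ) (lam ξ : ℝ) :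
    muExt X β lam ξ ≠ ∞ := by
  refine ENNReal.mul_ne_top ENNReal.ofReal_ne_top (ne_top_of_le_ne_top ?_
    ((iInf_le _ (∅ : Finset (Fin p))).trans
      (iInf₂_le (1 / 2 : ℝ) (by constructor <;> norm_num))))
  simp

/-- The `ℓ₁` error bound `μ(lam, ξ)` as a real number. -/
def mu (X : Matrix (Fin n) (Fin p) ℝ) (β : Fin p → ℝ) (lam ξ : ℝ) : ℝ :=
  (muExt X β lam ξ).toReal

/-- `τ_* = {lam0 μ(σ* lam0, ξ) / σ*}^{1/2}`. -/
def tauStar (X : Matrix (Fin n) (Fin p) ℝ) (y : Fin n → ℝ) (β : Fin p → ℝ) (lam0 ξ : ℝ) : ℝ :=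
  √(lam0 * mu X β (sigmaStar X y β * lam0) ξ / sigmaStar X y β)

/-- The event `z* ≤ (1 - τ_*²) lam0 (ξ - 1) / (ξ + 1)`. -/
def GoodEvent (X : Matrix (Fin n) (Fin p) ℝ) (y : Fin n → ℝ) (β : Fin p → ℝ)
    (lam0 ξ : ℝ) : Prop :=
  zStar X y β ≤ (1 - tauStar X y β lam0 ξ ^ 2) * lam0 * (ξ - 1) / (ξ + 1)

/-- The requirement `lam0 ≥ {(2/n) log(p/ε)}^{1/2} (ξ + 1) / {(ξ - 1)(1 - τ_*²)}`, which
presupposes `τ_* < 1`. It depends on `y` through `σ*` in `τ_*`. -/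
def PenaltyCondition (X : Matrix (Fin n) (Fin p) ℝ) (y : Fin n → ℝ) (β : Fin p → ℝ)
    (lam0 ξ ε : ℝ) : Prop :=
  tauStar X y β lam0 ξ ^ 2 < 1 ∧
    √(2 / n * Real.log (p / ε)) * (ξ + 1) / ((ξ - 1) * (1 - tauStar X y β lam0 ξ ^ 2)) ≤ lam0

/-- The law of `y` under `pr_{β,σ}`, that is, `y - X β ~ N(0, σ² I_n)`. -/
def pr (X : Matrix (Fin n) (Fin p) ℝ) (β : Fin p → ℝ) (σ : ℝ) : Measure (Fin n → ℝ) :=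
  (Measure.pi fun _ : Fin n => gaussianReal 0 (Real.toNNReal (σ ^ 2))).map
    fun e => X *ᵥ β + e

instance (X : Matrix (Fin n) (Fin p) ℝ) (β : Fin p → ℝ) (σ : ℝ) :
    IsProbabilityMeasure (pr X β σ) :=
  Measure.isProbabilityMeasure_map (by fun_prop)

/-- The columns are normalized: `|x_j|₂² = n`. -/
def ColumnsNormalized (X : Matrix (Fin n) (Fin p) ℝ) : Prop :=
  ∀ j, ∑ i, X i j ^ 2 = n

/-- The penalty level `A {(2/n) log p}^{1/2}`. -/
def penaltyLevel (A : ℝ) (n p : ℕ) : ℝ := A * √(2 / n * Real.log p)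

end ScaledLasso

end

/-! For fixed `σ` the joint loss is minimized in `b` by a lasso with penalty `σ λ₀`. Minimizing over
`σ` instead gives `σ = sigmaStar X y b`, by the arithmetic-geometric mean inequality, and leaves the
square root lasso loss. The proof plays these two views against each other.

Oracle inequalities. When `σ* z*` is at most `λ (ξ - 1) / (ξ + 1)`, the basic inequality for the
lasso with penalty `λ` bounds its `ℓ₁` error by `μ(λ, ξ)` (`l1_le_mu`). Put `t = (1 - τ_*²) σ*`. The
lasso at penalty `t λ₀` has residual level above `t` (when `τ_* > 0`), so the slope of the convex
joint loss in `σ` is negative there (`jointLoss_ge`) and `σ̂` cannot lie below `t`. This validates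
the error bound at penalty `σ̂ λ₀`. Comparison of square root lasso losses and the at most linear
growth of `μ` then bound `σ̂` from above.

Probability bound. `z*` is the largest absolute cosine between the Gaussian noise and the columns,
hence free of `σ`. By rotation invariance each cosine is distributed as one coordinate of a
normalized Gaussian vector, whose tail is that of Student's `t`. A union bound over `p` columns
yields `ε {n / (n - 3)}^{1/2} / (π L)^{1/2}` with `L = log (p / ε)`.

Asymptotic normality. It suffices that `σ̂ - σ* = o(n^{-1/2}) σ` in probability, because `σ*` obeys
the central limit theorem for the chi-square law. If `p` is large, the good event has probability
near one and the oracle inequality applies. If `p` stays below a constant, the penalty need not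
dominate the noise. Then the noise has bounded energy in the column space, and a separate
deterministic bound in terms of that energy takes over
(`IsScaledLasso.abs_sub_sigmaStar_le_of_energy`). -/

namespace ScaledLasso

/-! ### Elementary norm inequalities. -/

section Norms

variable {m : ℕ}

lemma l2_nonneg (v : Fin m → ℝ) : 0 ≤ l2 v := Real.sqrt_nonneg _

lemma l2_sq (v : Fin m → ℝ) : l2 v ^ 2 = v ⬝ᵥ v := by
  rw [l2, Real.sq_sqrt (Finset.sum_nonneg fun _ _ => sq_nonneg _)]
  simp [dotProduct, sq]

lemma l2_sq_eq_sum (v : Fin m → ℝ) : l2 v ^ 2 = ∑ i, v i ^ 2 :=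
  Real.sq_sqrt (Finset.sum_nonneg fun _ _ => sq_nonneg _)

lemma l2_eq_zero {v : Fin m → ℝ} (h : l2 v = 0) : v = 0 := by
  have h2 : ∑ i, v i ^ 2 = 0 := by rw [← l2_sq_eq_sum, h]; simp
  rw [Finset.sum_eq_zero_iff_of_nonneg fun i _ => sq_nonneg _] at h2
  ext i
  simpa using h2 i (Finset.mem_univ i)

lemma sq_dotProduct_le (v w : Fin m → ℝ) : (v ⬝ᵥ w) ^ 2 ≤ l2 v ^ 2 * l2 w ^ 2 := by
  rw [l2_sq_eq_sum, l2_sq_eq_sum]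
  exact Finset.sum_mul_sq_le_sq_mul_sq _ _ _

lemma dotProduct_le_l2_mul_l2 (v w : Fin m → ℝ) : v ⬝ᵥ w ≤ l2 v * l2 w := by
  refine le_of_sq_le_sq ?_ (mul_nonneg (l2_nonneg _) (l2_nonneg _))
  rw [mul_pow]
  exact sq_dotProduct_le v w

lemma abs_dotProduct_le (v w : Fin m → ℝ) : |v ⬝ᵥ w| ≤ ‖v‖ * l1 w := by
  rw [dotProduct, l1, Finset.mul_sum]
  refine (Finset.abs_sum_le_sum_abs _ _).trans (Finset.sum_le_sum fun i _ => ?_)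
  rw [abs_mul]
  exact mul_le_mul_of_nonneg_right (norm_le_pi_norm v i) (abs_nonneg _)

lemma l1_nonneg (v : Fin m → ℝ) : 0 ≤ l1 v := Finset.sum_nonneg fun _ _ => abs_nonneg _

lemma l1On_nonneg (T : Finset (Fin m)) (v : Fin m → ℝ) : 0 ≤ l1On T v :=
  Finset.sum_nonneg fun _ _ => abs_nonneg _

lemma l1_eq_l1On_add (T : Finset (Fin m)) (v : Fin m → ℝ) : l1 v = l1On T v + l1On Tᶜ v :=
  (Finset.sum_add_sum_compl T fun i => |v i|).symm

lemma l1_eq_zero {v : Fin m → ℝ} (h : l1 v = 0) : v = 0 := by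
  rw [l1, Finset.sum_eq_zero_iff_of_nonneg fun i _ => abs_nonneg _] at h
  ext i
  simpa using h i (Finset.mem_univ i)

lemma l1_add_le (v w : Fin m → ℝ) : l1 (v + w) ≤ l1 v + l1 w := by
  rw [l1, l1, l1, ← Finset.sum_add_distrib]
  exact Finset.sum_le_sum fun i _ => abs_add_le _ _

lemma l1_smul (c : ℝ) (v : Fin m → ℝ) : l1 (c • v) = |c| * l1 v := by
  simp [l1, abs_mul, Finset.mul_sum]

@[simp] lemma l1_zero : l1 (0 : Fin m → ℝ) = 0 := by simp [l1]

lemma l1_sub_comm (v w : Fin m → ℝ) : l1 (v - w) = l1 (w - v) := by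
  simp [l1, abs_sub_comm]

lemma l1_sub_le (v w : Fin m → ℝ) : l1 v - l1 w ≤ l1 (v - w) := by
  have := l1_add_le (v - w) w
  rw [sub_add_cancel] at this
  linarith

lemma continuous_l1 : Continuous (l1 : (Fin m → ℝ) → ℝ) := by
  unfold l1; fun_prop

lemma continuous_l2 : Continuous (l2 : (Fin m → ℝ) → ℝ) := by
  unfold l2; fun_prop

/-- The decomposition of the `ℓ₁` excess along a set `T` of coordinates. -/
lemma l1_sub_l1_le (T : Finset (Fin m)) (β b : Fin m → ℝ) :
    l1 β - l1 b ≤ l1On T (b - β) - l1On Tᶜ (b - β) + 2 * l1On Tᶜ β := by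
  have h1 : l1On T β ≤ l1On T b + l1On T (b - β) := by
    rw [l1On, l1On, l1On, ← Finset.sum_add_distrib]
    refine Finset.sum_le_sum fun i _ => ?_
    have := abs_sub_abs_le_abs_sub (β i) (b i)
    rw [abs_sub_comm] at this
    simp only [Pi.sub_apply]
    linarith
  have h2 : l1On Tᶜ (b - β) ≤ l1On Tᶜ b + l1On Tᶜ β := by
    rw [l1On, l1On, l1On, ← Finset.sum_add_distrib]
    exact Finset.sum_le_sum fun i _ => by
      simpa [sub_eq_add_neg] using abs_add_le (b i) (-β i)
  rw [l1_eq_l1On_add T β, l1_eq_l1On_add T b]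
  linarith

lemma l1On_pos_of_mem_cone {ξ : ℝ} {T : Finset (Fin m)} {h : Fin m → ℝ} (hc : h ∈ cone ξ T)
    (h0 : h ≠ 0) : 0 < l1On T h := by
  refine (l1On_nonneg T h).lt_of_ne fun hT => h0 (l1_eq_zero ?_)
  have hc' : l1On Tᶜ h ≤ ξ * l1On T h := hc
  rw [← hT, mul_zero] at hc'
  rw [l1_eq_l1On_add T h, ← hT, le_antisymm hc' (l1On_nonneg _ _), add_zero]

end Norms

variable {n p : ℕ}

lemma sq_l2_sub (v w : Fin n → ℝ) : l2 (v - w) ^ 2 = l2 v ^ 2 - 2 * (v ⬝ᵥ w) + l2 w ^ 2 := by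
  simp only [l2_sq, sub_dotProduct, dotProduct_sub, dotProduct_comm w v]
  ring

/-! ### The bound `μ` and the `ℓ₁` error of the lasso. -/

section ErrorBound

/-- The properties of a pair `(T, ν)` for which the maximum in the definition of `μ(lam, ξ)` is
at most `a`, with the compatibility factor eliminated. -/
structure DominatedBy (X : Matrix (Fin n) (Fin p) ℝ) (β : Fin p → ℝ) (lam ξ : ℝ)
    (T : Finset (Fin p)) (ν a : ℝ) : Prop where
  pos : 0 < ν
  lt_one : ν < 1
  nonneg : 0 ≤ a
  bias_le : l1On Tᶜ β ≤ a * ν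
  var_le : ∀ h ∈ cone ((ξ + ν) / (1 - ν)) T, h ≠ 0 →
    lam * T.card / (2 * (1 - ν)) * (n * l1On T h ^ 2) ≤ a * (T.card * l2 (X *ᵥ h) ^ 2)

lemma mul_le_of_div_compat_le {X : Matrix (Fin n) (Fin p) ℝ} {ξ N a : ℝ} {T : Finset (Fin p)}
    (hn : 0 < n) (ha : 0 ≤ a)
    (H : ENNReal.ofReal N / compat X ξ T ^ 2 ≤ ENNReal.ofReal a) {h : Fin p → ℝ}
    (hc : h ∈ cone ξ T) (h0 : h ≠ 0) :
    N * (n * l1On T h ^ 2) ≤ a * (T.card * l2 (X *ᵥ h) ^ 2) := by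
  have hT := l1On_pos_of_mem_cone hc h0
  have hn' : (0 : ℝ) < n := by exact_mod_cast hn
  set r := √(T.card : ℝ) * l2 (X *ᵥ h) / (√(n : ℝ) * l1On T h) with hr
  have hr0 : 0 ≤ r := div_nonneg (mul_nonneg (Real.sqrt_nonneg _) (l2_nonneg _)) (by positivity)
  have hcr : compat X ξ T ≤ ENNReal.ofReal r := iInf₂_le (α := ℝ≥0∞) h ⟨hc, h0⟩
  have hle : ENNReal.ofReal N ≤ ENNReal.ofReal a * compat X ξ T ^ 2 := by
    have hct : compat X ξ T ^ 2 ≠ ∞ := ENNReal.pow_ne_top (ne_top_of_le_ne_top ENNReal.ofReal_ne_top hcr)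
    -- For `compat = 0` the quotient is `∞` unless the numerator vanishes too, and `0 / 0 = 0` in
    -- `ℝ≥0∞`.
    by_cases hc0 : compat X ξ T ^ 2 = 0
    · rw [hc0] at H ⊢
      by_cases hN0 : ENNReal.ofReal N = 0
      · simp [hN0]
      · rw [ENNReal.div_zero hN0] at H
        exact absurd H (by simp)
    · exact (ENNReal.div_le_iff hc0 hct).1 H
  have hle2 : ENNReal.ofReal N ≤ ENNReal.ofReal (a * r ^ 2) := by
    rw [ENNReal.ofReal_mul ha, ENNReal.ofReal_pow hr0]
    exact hle.trans (by gcongr)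
  have hle3 : N ≤ a * r ^ 2 := (ENNReal.ofReal_le_ofReal_iff (by positivity)).1 hle2
  have hr2 : r ^ 2 * (n * l1On T h ^ 2) = T.card * l2 (X *ᵥ h) ^ 2 := by
    rw [hr, div_pow, mul_pow, mul_pow, Real.sq_sqrt (by positivity), Real.sq_sqrt hn'.le]
    field_simp
  calc N * (n * l1On T h ^ 2) ≤ a * r ^ 2 * (n * l1On T h ^ 2) := by gcongr
    _ = _ := by rw [mul_assoc, hr2]

lemma dominatedBy_of_max_le {X : Matrix (Fin n) (Fin p) ℝ} {β : Fin p → ℝ} {lam ξ ν a : ℝ}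
    {T : Finset (Fin p)} (hn : 0 < n) (hν : ν ∈ Set.Ioo (0 : ℝ) 1) (ha : 0 ≤ a)
    (H : max (ENNReal.ofReal (l1On Tᶜ β / ν)) (ENNReal.ofReal (lam * T.card / (2 * (1 - ν))) /
      compat X ((ξ + ν) / (1 - ν)) T ^ 2) ≤ ENNReal.ofReal a) :
    DominatedBy X β lam ξ T ν a where
  pos := hν.1
  lt_one := hν.2
  nonneg := ha
  bias_le := (div_le_iff₀ hν.1).1
    ((ENNReal.ofReal_le_ofReal_iff ha).1 ((le_max_left _ _).trans H))
  var_le _ hc h0 := mul_le_of_div_compat_le hn ha ((le_max_right _ _).trans H) hc h0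

/-- With `exists_dominatedBy_lt`, the interface to the infimum defining `μ`: pairs with infinite
maximum can be ignored, the others yield real inequalities. -/
lemma le_mu {X : Matrix (Fin n) (Fin p) ℝ} {β : Fin p → ℝ} {lam ξ ℓ : ℝ}
    (hn : 0 < n) (hξ : 0 ≤ ξ)
    (H : ∀ T ν a, DominatedBy X β lam ξ T ν a → ℓ ≤ (ξ + 1) * a) : ℓ ≤ mu X β lam ξ := by
  refine (ENNReal.ofReal_le_iff_le_toReal (muExt_ne_top X β lam ξ)).1 ?_
  have hξ0 : ENNReal.ofReal (ξ + 1) ≠ 0 := by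
    rw [Ne, ENNReal.ofReal_eq_zero]; linarith
  rw [muExt, mul_comm, ← ENNReal.div_le_iff hξ0 ENNReal.ofReal_ne_top]
  refine le_iInf fun T => le_iInf₂ fun ν hν => ?_
  set M := max (ENNReal.ofReal (l1On Tᶜ β / ν)) (ENNReal.ofReal (lam * T.card / (2 * (1 - ν))) /
      compat X ((ξ + ν) / (1 - ν)) T ^ 2) with hM
  by_cases htop : M = ∞
  · rw [htop]; exact le_top
  have := H T ν M.toReal (dominatedBy_of_max_le hn hν ENNReal.toReal_nonneg
    (by rw [ENNReal.ofReal_toReal htop]))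
  rw [ENNReal.div_le_iff hξ0 ENNReal.ofReal_ne_top]
  conv_rhs => rw [← ENNReal.ofReal_toReal htop]
  rw [← ENNReal.ofReal_mul ENNReal.toReal_nonneg, mul_comm]
  exact ENNReal.ofReal_le_ofReal this

/-- The slack `δ` is there because the infimum over the open interval of `ν` need not be attained.
-/
lemma exists_dominatedBy_lt {X : Matrix (Fin n) (Fin p) ℝ} {β : Fin p → ℝ} {lam ξ δ : ℝ}
    (hn : 0 < n) (hξ : 0 ≤ ξ) (hδ : 0 < δ) :
    ∃ T ν a, DominatedBy X β lam ξ T ν a ∧ (ξ + 1) * a < mu X β lam ξ + δ := by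
  have hξ0 : ENNReal.ofReal (ξ + 1) ≠ 0 := by
    rw [Ne, ENNReal.ofReal_eq_zero]; linarith
  have hlt : muExt X β lam ξ < ENNReal.ofReal (mu X β lam ξ + δ) := by
    rw [mu, ENNReal.ofReal_add ENNReal.toReal_nonneg hδ.le,
      ENNReal.ofReal_toReal (muExt_ne_top X β lam ξ)]
    exact ENNReal.lt_add_right (muExt_ne_top X β lam ξ) (by simpa using hδ)
  have hlt' := hlt
  rw [muExt, mul_comm, ← ENNReal.lt_div_iff_mul_lt (.inl hξ0) (.inl ENNReal.ofReal_ne_top)] at hlt'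
  simp only [iInf_lt_iff] at hlt'
  obtain ⟨T, ν, hν, hlt'⟩ := hlt'
  refine ⟨T, ν, _, dominatedBy_of_max_le hn hν ENNReal.toReal_nonneg
    (by rw [ENNReal.ofReal_toReal hlt'.ne_top]), ?_⟩
  rw [ENNReal.lt_div_iff_mul_lt (.inl hξ0) (.inl ENNReal.ofReal_ne_top), mul_comm] at hlt'
  have := (ENNReal.lt_ofReal_iff_toReal_lt hlt'.ne_top).1 hlt'
  rwa [ENNReal.toReal_mul, ENNReal.toReal_ofReal (by linarith)] at this

lemma mu_nonneg (X : Matrix (Fin n) (Fin p) ℝ) (β : Fin p → ℝ) (lam ξ : ℝ) : 0 ≤ mu X β lam ξ :=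
  ENNReal.toReal_nonneg

/-- `μ(·, ξ)` grows at most linearly. -/
lemma mu_le_mul_mu (X : Matrix (Fin n) (Fin p) ℝ) (β : Fin p → ℝ) {lam lam' c : ℝ} (ξ : ℝ)
    (hc : 1 ≤ c) (hlam : lam' ≤ c * lam) : mu X β lam' ξ ≤ c * mu X β lam ξ := by
  have hc0 : 0 ≤ c := zero_le_one.trans hc
  have hc1 : 1 ≤ ENNReal.ofReal c := by simpa using ENNReal.ofReal_le_ofReal hc
  have key : muExt X β lam' ξ ≤ ENNReal.ofReal c * muExt X β lam ξ := by
    rw [muExt, muExt, mul_left_comm]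
    gcongr
    rw [ENNReal.mul_iInf_of_ne (by simpa using zero_lt_one.trans_le hc) ENNReal.ofReal_ne_top]
    refine iInf_mono fun T => ?_
    rw [ENNReal.mul_iInf_of_ne (by simpa using zero_lt_one.trans_le hc) ENNReal.ofReal_ne_top]
    refine iInf_mono fun ν => ?_
    by_cases hν : ν ∈ Set.Ioo (0 : ℝ) 1
    · simp only [hν, iInf_pos]
      have hν1 : 0 < 1 - ν := by linarith [hν.2]
      refine max_le ?_ ?_
      -- The bias term does not scale with `lam`; this is where `1 ≤ c` enters.
      · calc _ = 1 * ENNReal.ofReal (l1On Tᶜ β / ν) := (one_mul _).symm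
          _ ≤ _ := by gcongr; exact le_max_left _ _
      · calc _ ≤ ENNReal.ofReal c * (ENNReal.ofReal (lam * T.card / (2 * (1 - ν))) /
                compat X ((ξ + ν) / (1 - ν)) T ^ 2) := by
              rw [← mul_div_assoc, ← ENNReal.ofReal_mul hc0]
              gcongr
              rw [← mul_div_assoc, ← mul_assoc]
              gcongr
          _ ≤ _ := by gcongr; exact le_max_right _ _
    · simp [hν, ENNReal.mul_top (zero_lt_one.trans_le hc1).ne']
  have := ENNReal.toReal_mono (ENNReal.mul_ne_top ENNReal.ofReal_ne_top (muExt_ne_top _ _ _ _)) key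
  rwa [ENNReal.toReal_mul, ENNReal.toReal_ofReal hc0] at this

/-- The basic inequality of the lasso implies the `ℓ₁` error bound. -/
lemma l1_le_mu {X : Matrix (Fin n) (Fin p) ℝ} {β b : Fin p → ℝ} {lam ξ : ℝ}
    (hn : 0 < n) (hlam : 0 < lam) (hξ : 1 < ξ)
    (H : l2 (X *ᵥ (b - β)) ^ 2 / n ≤
      lam * (ξ - 1) / (ξ + 1) * l1 (b - β) + lam * (l1 β - l1 b)) :
    l1 (b - β) ≤ mu X β lam ξ := by
  refine le_mu hn (by linarith) fun T ν a hd => ?_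
  obtain ⟨hν0, hν1, ha, hbias, hvar⟩ := hd
  have hn' : (0 : ℝ) < n := by exact_mod_cast hn
  have hdec := l1_sub_l1_le T β b
  set h := b - β with hh
  set q := l2 (X *ᵥ h) ^ 2 / n with hq
  have hq0 : 0 ≤ q := by positivity
  have hl1 := l1_eq_l1On_add T h
  set x := l1On T h with hx
  set z := l1On Tᶜ h with hz
  have hx0 : 0 ≤ x := l1On_nonneg _ _
  have hz0 : 0 ≤ z := l1On_nonneg _ _
  set B := l1On Tᶜ β with hB
  have hbasic : (ξ + 1) * q ≤ 2 * lam * (ξ * x - z + (ξ + 1) * B) := by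
    have : q ≤ lam * (ξ - 1) / (ξ + 1) * (x + z) + lam * (x - z + 2 * B) := by
      rw [← hl1]; exact H.trans (by gcongr)
    calc (ξ + 1) * q ≤ (ξ + 1) * (lam * (ξ - 1) / (ξ + 1) * (x + z) + lam * (x - z + 2 * B)) := by
          gcongr
      _ = _ := by field_simp; ring
  rw [hl1]
  -- Either the error is controlled by the bias alone, or the bias term is absorbed into a fraction
  -- `ν` of the error. The latter enlarges the cone constant from `ξ` to `(ξ + ν) / (1 - ν)`.
  rcases le_or_gt (ν * (x + z)) ((ξ + 1) * B) with hcase | hcase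
  · have : ν * (x + z) ≤ ν * ((ξ + 1) * a) := by nlinarith
    exact le_of_mul_le_mul_left this hν0
  have hqn : (ξ + 1) * q ≤ 2 * lam * ((ξ + 1) * x - (1 - ν) * (x + z)) := by
    refine hbasic.trans (mul_le_mul_of_nonneg_left ?_ (by positivity))
    linarith
  have hν1' : 0 < 1 - ν := by linarith
  have hcone : h ∈ cone ((ξ + ν) / (1 - ν)) T := by
    change z ≤ (ξ + ν) / (1 - ν) * x
    rw [div_mul_eq_mul_div, le_div_iff₀ hν1']
    have : 0 ≤ 2 * lam * ((ξ + 1) * x - (1 - ν) * (x + z)) := le_trans (by positivity) hqn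
    have := nonneg_of_mul_nonneg_right this (by positivity)
    linarith
  have hne : h ≠ 0 := by
    intro h0
    have : x + z = 0 := by rw [← hl1, h0, l1_zero]
    rw [this, mul_zero] at hcase
    exact absurd hcase (not_lt.2 (mul_nonneg (by linarith) (l1On_nonneg _ _)))
  have hxpos : 0 < x := l1On_pos_of_mem_cone hcone hne
  have hTpos : (0 : ℝ) < T.card := by
    rw [Nat.cast_pos, Finset.card_pos, Finset.nonempty_iff_ne_empty]
    rintro rfl
    exact hxpos.ne' Finset.sum_empty
  have hv : lam * x ^ 2 ≤ 2 * (1 - ν) * a * q := by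
    have h1 := hvar h hcone hne
    have h2 : l2 (X *ᵥ h) ^ 2 = q * n := by rw [hq]; field_simp
    rw [h2, div_mul_eq_mul_div, div_le_iff₀ (by positivity)] at h1
    have h3 : (T.card * n : ℝ) * (lam * x ^ 2) ≤ (T.card * n) * (2 * (1 - ν) * a * q) := by
      linarith
    exact le_of_mul_le_mul_left h3 (mul_pos hTpos hn')
  have hapos : 0 < a := by
    refine ha.lt_of_ne fun h0 => ?_
    rw [← h0] at hv
    have : 0 < lam * x ^ 2 := by positivity
    have h1 : 2 * (1 - ν) * 0 * q = 0 := by ring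
    linarith
  -- with `y = (1 - ν) (x + z)`, `(ξ + 1) (x - x² / (4 (1 - ν) a)) ≥ y`
  have h4 : (1 - ν) * (x + z) * (4 * (1 - ν) * a) ≤
      (ξ + 1) * (x * (4 * (1 - ν) * a) - x ^ 2) := by
    have e1 : (ξ + 1) * (lam * x ^ 2) ≤ 2 * (1 - ν) * a * (2 * lam * ((ξ + 1) * x - (1 - ν) * (x + z))) := by
      calc (ξ + 1) * (lam * x ^ 2) ≤ (ξ + 1) * (2 * (1 - ν) * a * q) := by gcongr
        _ = 2 * (1 - ν) * a * ((ξ + 1) * q) := by ring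
        _ ≤ _ := by gcongr
    have e2 : lam * ((ξ + 1) * x ^ 2) ≤ lam * (4 * (1 - ν) * a * ((ξ + 1) * x - (1 - ν) * (x + z))) := by
      linarith
    have e3 := le_of_mul_le_mul_left e2 hlam
    linarith
  -- The maximum of the quadratic in `x`, attained at `x = 2 (1 - ν) a`.
  have h5 : x * (4 * (1 - ν) * a) - x ^ 2 ≤ (2 * (1 - ν) * a) ^ 2 := by
    nlinarith [sq_nonneg (x - 2 * (1 - ν) * a)]
  have h6 : (4 * (1 - ν) ^ 2 * a) * (x + z) ≤ (4 * (1 - ν) ^ 2 * a) * ((ξ + 1) * a) := by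
    have := mul_le_mul_of_nonneg_left h5 (by linarith : (0 : ℝ) ≤ ξ + 1)
    linarith
  exact le_of_mul_le_mul_left h6 (by positivity)

end ErrorBound

/-! ### First order conditions and convexity of the joint loss. -/

section Optimality

variable {X : Matrix (Fin n) (Fin p) ℝ} {y : Fin n → ℝ} {lam0 : ℝ}

lemma sigmaStar_nonneg (X : Matrix (Fin n) (Fin p) ℝ) (y : Fin n → ℝ) (b : Fin p → ℝ) :
    0 ≤ sigmaStar X y b := div_nonneg (l2_nonneg _) (Real.sqrt_nonneg _)

lemma sigmaStar_sq (X : Matrix (Fin n) (Fin p) ℝ) (y : Fin n → ℝ) (b : Fin p → ℝ) :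
    sigmaStar X y b ^ 2 = l2 (y - X *ᵥ b) ^ 2 / n := by
  rw [sigmaStar, div_pow, Real.sq_sqrt (Nat.cast_nonneg _)]

lemma jointLoss_eq (X : Matrix (Fin n) (Fin p) ℝ) (y : Fin n → ℝ) (lam0 : ℝ) (b : Fin p → ℝ)
    (s : ℝ) : jointLoss X y lam0 b s = sigmaStar X y b ^ 2 / (2 * s) + s / 2 + lam0 * l1 b := by
  rw [jointLoss, sigmaStar_sq, div_div]
  ring_nf

lemma eq_mulVec_of_sigmaStar_eq_zero (hn : 0 < n) {b : Fin p → ℝ} (h : sigmaStar X y b = 0) :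
    y = X *ᵥ b := by
  have hn' : √(n : ℝ) ≠ 0 := (Real.sqrt_pos.2 (by exact_mod_cast hn)).ne'
  rw [sigmaStar, div_eq_zero_iff, or_iff_left hn'] at h
  exact sub_eq_zero.1 (l2_eq_zero h)

lemma admissible_sigmaStar (hn : 0 < n) (b : Fin p → ℝ) : Admissible X y b (sigmaStar X y b) :=
  ⟨sigmaStar_nonneg _ _ _, eq_mulVec_of_sigmaStar_eq_zero hn⟩

lemma jointLoss_sigmaStar (X : Matrix (Fin n) (Fin p) ℝ) (y : Fin n → ℝ) (lam0 : ℝ)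
    (b : Fin p → ℝ) : jointLoss X y lam0 b (sigmaStar X y b) = sigmaStar X y b + lam0 * l1 b := by
  rw [jointLoss_eq]
  rcases eq_or_ne (sigmaStar X y b) 0 with h | h
  -- At level zero the convention `0 / 0 = 0` gives the quotient its correct value `0`.
  · simp [h]
  · field_simp
    ring

lemma sigmaStar_eq_zero {b : Fin p → ℝ} (h : y = X *ᵥ b) : sigmaStar X y b = 0 := by
  simp [sigmaStar, ← h, l2]

/-- The noise level of a scaled lasso estimate is the normalized length of its residual. -/
lemma IsScaledLasso.shat_eq (hn : 0 < n) {bhat : Fin p → ℝ} {shat : ℝ}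
    (h : IsScaledLasso X y lam0 bhat shat) : shat = sigmaStar X y bhat := by
  rcases h.1.1.eq_or_lt with h0 | h0
  · rw [← h0, sigmaStar_eq_zero (h.1.2 h0.symm)]
  have := h.2 bhat _ (admissible_sigmaStar hn bhat)
  rw [jointLoss_sigmaStar, jointLoss_eq] at this
  set c := sigmaStar X y bhat
  -- The reverse of the arithmetic-geometric mean inequality, so equality holds.
  have h1 : c ^ 2 / (2 * shat) + shat / 2 ≤ c := by linarith
  have h2 : (c - shat) ^ 2 ≤ 0 := by
    have : c ^ 2 / (2 * shat) + shat / 2 = (c ^ 2 + shat ^ 2) / (2 * shat) := by field_simp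
    rw [this, div_le_iff₀ (by positivity)] at h1
    nlinarith
  have h3 : c - shat = 0 := by
    have := le_antisymm h2 (sq_nonneg _)
    simpa using this
  linarith

/-- The slope of a scaled lasso estimate minimizes the square root lasso loss. -/
lemma IsScaledLasso.le_sqrtLoss (hn : 0 < n) {bhat : Fin p → ℝ} {shat : ℝ}
    (h : IsScaledLasso X y lam0 bhat shat) (b : Fin p → ℝ) :
    shat + lam0 * l1 bhat ≤ sigmaStar X y b + lam0 * l1 b := by
  have := h.2 b _ (admissible_sigmaStar hn b)
  rwa [h.shat_eq hn, jointLoss_sigmaStar, jointLoss_sigmaStar, ← h.shat_eq hn] at this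

/-- The first order condition for the lasso in variational form. -/
lemma lasso_variational (hn : 0 < n) {lam : ℝ} (hlam : 0 ≤ lam) {b₀ : Fin p → ℝ}
    (hmin : ∀ b, l2 (y - X *ᵥ b₀) ^ 2 / (2 * n) + lam * l1 b₀ ≤
      l2 (y - X *ᵥ b) ^ 2 / (2 * n) + lam * l1 b) (b : Fin p → ℝ) :
    (y - X *ᵥ b₀) ⬝ᵥ (X *ᵥ (b - b₀)) / n ≤ lam * (l1 b - l1 b₀) := by
  have hn' : (0 : ℝ) < n := by exact_mod_cast hn
  set c := (y - X *ᵥ b₀) ⬝ᵥ (X *ᵥ (b - b₀)) / n with hc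
  set d := l2 (X *ᵥ (b - b₀)) ^ 2 / (2 * n) with hd
  -- Minimality along the segment from `b₀` to `b`, divided by `θ`; the limit `θ → 0` removes the
  -- quadratic term.
  have key : ∀ θ : ℝ, 0 < θ → θ ≤ 1 → c ≤ lam * (l1 b - l1 b₀) + θ * d := by
    intro θ h0 h1
    have hm := hmin (b₀ + θ • (b - b₀))
    have e1 : y - X *ᵥ (b₀ + θ • (b - b₀)) = (y - X *ᵥ b₀) - θ • X *ᵥ (b - b₀) := by
      rw [mulVec_add, mulVec_smul]; abel
    have e2 : l2 (θ • X *ᵥ (b - b₀)) ^ 2 = θ ^ 2 * l2 (X *ᵥ (b - b₀)) ^ 2 := by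
      simp only [l2_sq, smul_dotProduct, dotProduct_smul, smul_eq_mul]; ring
    rw [e1, sq_l2_sub (y - X *ᵥ b₀), e2, dotProduct_smul, smul_eq_mul] at hm
    have e3 : l1 (b₀ + θ • (b - b₀)) ≤ (1 - θ) * l1 b₀ + θ * l1 b := by
      have : b₀ + θ • (b - b₀) = (1 - θ) • b₀ + θ • b := by
        rw [smul_sub, sub_smul, one_smul]; abel
      rw [this]
      refine (l1_add_le _ _).trans ?_
      rw [l1_smul, l1_smul, abs_of_nonneg h0.le, abs_of_nonneg (by linarith)]
    have e4 := mul_le_mul_of_nonneg_left e3 hlam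
    have e5 : (l2 (y - X *ᵥ b₀) ^ 2 - 2 * (θ * ((y - X *ᵥ b₀) ⬝ᵥ X *ᵥ (b - b₀))) +
        θ ^ 2 * l2 (X *ᵥ (b - b₀)) ^ 2) / (2 * n) =
        l2 (y - X *ᵥ b₀) ^ 2 / (2 * n) - θ * c + θ * (θ * d) := by
      rw [hc, hd]; field_simp
    rw [e5] at hm
    have : θ * c ≤ θ * (lam * (l1 b - l1 b₀) + θ * d) := by linarith
    exact le_of_mul_le_mul_left this h0
  have hlim : Tendsto (fun θ : ℝ => lam * (l1 b - l1 b₀) + θ * d) (𝓝[>] 0)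
      (𝓝 (lam * (l1 b - l1 b₀) + 0 * d)) :=
    ((continuous_const.add (continuous_id.mul continuous_const)).tendsto 0).mono_left
      nhdsWithin_le_nhds
  rw [zero_mul, add_zero] at hlim
  refine ge_of_tendsto hlim ?_
  filter_upwards [Ioc_mem_nhdsGT (zero_lt_one : (0 : ℝ) < 1)] with θ hθ
  exact key θ hθ.1 hθ.2

lemma IsScaledLasso.variational (hn : 0 < n) (hlam0 : 0 ≤ lam0) {bhat : Fin p → ℝ} {shat : ℝ}
    (h : IsScaledLasso X y lam0 bhat shat) (b : Fin p → ℝ) :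
    (y - X *ᵥ bhat) ⬝ᵥ (X *ᵥ (b - bhat)) / n ≤ shat * lam0 * (l1 b - l1 bhat) := by
  rcases h.1.1.eq_or_lt with h0 | h0
  · have := h.1.2 h0.symm
    simp [← h0, ← this]
  refine lasso_variational hn (mul_nonneg h0.le hlam0) (fun b => ?_) b
  have h1 := h.2 b shat ⟨h0.le, fun h' => absurd h' h0.ne'⟩
  have h2 : shat * (l2 (y - X *ᵥ bhat) ^ 2 / (2 * n * shat) + lam0 * l1 bhat) ≤
      shat * (l2 (y - X *ᵥ b) ^ 2 / (2 * n * shat) + lam0 * l1 b) := by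
    refine mul_le_mul_of_nonneg_left ?_ h0.le
    rw [jointLoss, jointLoss] at h1
    linarith
  have h3 : ∀ v : ℝ, shat * (v / (2 * n * shat)) = v / (2 * n) := by
    intro v; field_simp
  rw [mul_add, mul_add, h3, h3] at h2
  linarith

/-- The first order condition at `b` in terms of the errors. -/
lemma sq_l2_mulVec_sub_le {lam : ℝ} {b β : Fin p → ℝ}
    (h : (y - X *ᵥ b) ⬝ᵥ (X *ᵥ (β - b)) / n ≤ lam * (l1 β - l1 b)) :
    l2 (X *ᵥ (b - β)) ^ 2 / n ≤
      (y - X *ᵥ β) ⬝ᵥ (X *ᵥ (b - β)) / n + lam * (l1 β - l1 b) := by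
  have e : (y - X *ᵥ b) ⬝ᵥ (X *ᵥ (β - b)) =
      l2 (X *ᵥ (b - β)) ^ 2 - (y - X *ᵥ β) ⬝ᵥ (X *ᵥ (b - β)) := by
    have e1 : y - X *ᵥ b = (y - X *ᵥ β) - X *ᵥ (b - β) := by rw [mulVec_sub]; abel
    have e2 : X *ᵥ (β - b) = -(X *ᵥ (b - β)) := by rw [← mulVec_neg, neg_sub]
    rw [e1, e2, l2_sq, dotProduct_neg, sub_dotProduct]
    ring
  rw [e, sub_div] at h
  linarith

/-- The lasso with a positive penalty level has a solution. -/
lemma exists_lasso (X : Matrix (Fin n) (Fin p) ℝ) (y : Fin n → ℝ) {lam : ℝ} (hlam : 0 < lam) :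
    ∃ b₀, ∀ b, l2 (y - X *ᵥ b₀) ^ 2 / (2 * n) + lam * l1 b₀ ≤
      l2 (y - X *ᵥ b) ^ 2 / (2 * n) + lam * l1 b := by
  have hcont : Continuous fun b : Fin p → ℝ => l2 (y - X *ᵥ b) ^ 2 / (2 * n) + lam * l1 b := by
    have h1 : Continuous fun b : Fin p → ℝ => l2 (y - X *ᵥ b) := continuous_l2.comp (by fun_prop)
    have h2 := continuous_l1 (m := p)
    fun_prop
  refine hcont.exists_forall_le (tendsto_atTop_mono (fun b => ?_)
    (tendsto_norm_cocompact_atTop.const_mul_atTop hlam))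
  have h1 : ‖b‖ ≤ l1 b := (pi_norm_le_iff_of_nonneg (l1_nonneg b)).2 fun i =>
    Finset.single_le_sum (f := fun i => |b i|) (fun _ _ => abs_nonneg _) (Finset.mem_univ i)
  have h2 := mul_le_mul_of_nonneg_left h1 hlam.le
  have : 0 ≤ l2 (y - X *ᵥ b) ^ 2 / (2 * n) := by positivity
  linarith

/-- A subgradient of the joint loss at a point of the lasso path. -/
lemma jointLoss_ge {t : ℝ} (hn : 0 < n) (ht : 0 < t) {b₀ : Fin p → ℝ}
    (h : ∀ b, (y - X *ᵥ b₀) ⬝ᵥ (X *ᵥ (b - b₀)) / n ≤ t * lam0 * (l1 b - l1 b₀))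
    {b : Fin p → ℝ} {s : ℝ} (hbs : Admissible X y b s) :
    jointLoss X y lam0 b₀ t + (s - t) * ((1 - (sigmaStar X y b₀ / t) ^ 2) / 2) ≤
      jointLoss X y lam0 b s := by
  have hn' : (0 : ℝ) < n := by exact_mod_cast hn
  have hb := h b
  set a := sigmaStar X y b₀ with ha
  set c := sigmaStar X y b with hc
  set d := (y - X *ᵥ b₀) ⬝ᵥ (y - X *ᵥ b) / n with hd
  have e1 : (y - X *ᵥ b₀) ⬝ᵥ (X *ᵥ (b - b₀)) / n = a ^ 2 - d := by
    have : X *ᵥ (b - b₀) = (y - X *ᵥ b₀) - (y - X *ᵥ b) := by rw [mulVec_sub]; abel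
    rw [this, dotProduct_sub, sub_div, ← l2_sq, ha, sigmaStar_sq]
  have hda : d ≤ a * c := by
    have h1 := dotProduct_le_l2_mul_l2 (y - X *ᵥ b₀) (y - X *ᵥ b)
    have h2 : a * c = l2 (y - X *ᵥ b₀) * l2 (y - X *ᵥ b) / n := by
      rw [ha, hc, sigmaStar, sigmaStar, div_mul_div_comm, Real.mul_self_sqrt hn'.le]
    rw [h2, hd]
    gcongr
  rw [e1] at hb
  -- The perspective `c² / (2 s)` lies above its tangent plane at `(a, t)`, by `(c - s a / t)² ≥ 0`.
  -- At `s = 0` admissibility forces `c = 0`.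
  have hcs : a / t * c - s * (a / t) ^ 2 / 2 ≤ c ^ 2 / (2 * s) := by
    rcases hbs.1.eq_or_lt with h0 | h0
    · have : c = 0 := sigmaStar_eq_zero (hbs.2 h0.symm)
      simp [← h0, this]
    · rw [le_div_iff₀ (by positivity)]
      nlinarith [sq_nonneg (c - s * (a / t))]
  have e2 : a ^ 2 / t - lam0 * (l1 b - l1 b₀) ≤ a / t * c := by
    have h3 : a ^ 2 - t * lam0 * (l1 b - l1 b₀) ≤ a * c := by linarith
    have h4 := div_le_div_of_nonneg_right h3 ht.le
    have h5 : (a ^ 2 - t * lam0 * (l1 b - l1 b₀)) / t = a ^ 2 / t - lam0 * (l1 b - l1 b₀) := by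
      field_simp
    rw [h5] at h4
    calc _ ≤ _ := h4
      _ = _ := by ring
  rw [jointLoss_eq, jointLoss_eq]
  have e3 : a ^ 2 / (2 * t) + t / 2 + (s - t) * ((1 - (a / t) ^ 2) / 2) =
      a ^ 2 / t + s / 2 - s * (a / t) ^ 2 / 2 := by
    field_simp; ring
  linarith

end Optimality

end ScaledLasso

namespace ScaledLasso

variable {n p : ℕ} {X : Matrix (Fin n) (Fin p) ℝ} {y : Fin n → ℝ} {β : Fin p → ℝ} {lam0 ξ : ℝ}

/-! ### The deterministic oracle inequalities. -/

section OracleInequality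

lemma pos_of_sigmaStar_pos (h : 0 < sigmaStar X y β) : 0 < n := by
  rcases Nat.eq_zero_or_pos n with rfl | hn
  · simp [sigmaStar] at h
  · exact hn

lemma zStar_nonneg (X : Matrix (Fin n) (Fin p) ℝ) (y : Fin n → ℝ) (β : Fin p → ℝ) :
    0 ≤ zStar X y β := div_nonneg (norm_nonneg _) (sigmaStar_nonneg _ _ _)

lemma dotProduct_mulVec_le_zStar (hσ : 0 < sigmaStar X y β) (u : Fin p → ℝ) :
    (y - X *ᵥ β) ⬝ᵥ (X *ᵥ u) / n ≤ sigmaStar X y β * zStar X y β * l1 u := by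
  have e1 : (y - X *ᵥ β) ⬝ᵥ (X *ᵥ u) / n = ((n : ℝ)⁻¹ • (Xᵀ *ᵥ (y - X *ᵥ β))) ⬝ᵥ u := by
    rw [smul_dotProduct, dotProduct_mulVec, ← mulVec_transpose, smul_eq_mul]
    ring
  rw [e1, zStar, mul_div_cancel₀ _ hσ.ne']
  exact (le_abs_self _).trans (abs_dotProduct_le _ _)

/-- Convexity of the residual norm: its gradient at `β` has maximum norm `z*`. The gradient
inequality is Cauchy-Schwarz applied to the two residuals. -/
lemma sigmaStar_sub_le (hσ : 0 < sigmaStar X y β) (b : Fin p → ℝ) :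
    sigmaStar X y β - zStar X y β * l1 (b - β) ≤ sigmaStar X y b := by
  have hn := pos_of_sigmaStar_pos hσ
  have hn' : (0 : ℝ) < n := by exact_mod_cast hn
  have h1 := dotProduct_le_l2_mul_l2 (y - X *ᵥ β) (y - X *ᵥ b)
  have h2 : sigmaStar X y β * sigmaStar X y b = l2 (y - X *ᵥ β) * l2 (y - X *ᵥ b) / n := by
    rw [sigmaStar, sigmaStar, div_mul_div_comm, Real.mul_self_sqrt hn'.le]
  have h3 : y - X *ᵥ b = (y - X *ᵥ β) - X *ᵥ (b - β) := by rw [mulVec_sub]; abel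
  rw [h3, dotProduct_sub, ← l2_sq, ← h3] at h1
  have h4 := div_le_div_of_nonneg_right h1 hn'.le
  rw [sub_div, ← sigmaStar_sq, ← h2] at h4
  have h5 := dotProduct_mulVec_le_zStar hσ (b - β)
  refine le_of_mul_le_mul_left ?_ hσ
  linarith

lemma tauStar_sq (X : Matrix (Fin n) (Fin p) ℝ) (y : Fin n → ℝ) (β : Fin p → ℝ) (ξ : ℝ)
    (hlam0 : 0 ≤ lam0) :
    tauStar X y β lam0 ξ ^ 2 = lam0 * mu X β (sigmaStar X y β * lam0) ξ / sigmaStar X y β :=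
  Real.sq_sqrt (div_nonneg (mul_nonneg hlam0 (mu_nonneg _ _ _ _)) (sigmaStar_nonneg _ _ _))

/-- If the noise is dominated by the penalty level then `μ` bounds the `ℓ₁` error of the lasso. -/
lemma l1_sub_le_mu_of_variational (hσ : 0 < sigmaStar X y β) {lam : ℝ} (hlam : 0 < lam)
    (hξ : 1 < ξ) (hz : sigmaStar X y β * zStar X y β ≤ lam * (ξ - 1) / (ξ + 1)) {b : Fin p → ℝ}
    (hb : (y - X *ᵥ b) ⬝ᵥ (X *ᵥ (β - b)) / n ≤ lam * (l1 β - l1 b)) :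
    l1 (b - β) ≤ mu X β lam ξ := by
  refine l1_le_mu (pos_of_sigmaStar_pos hσ) hlam hξ ((sq_l2_mulVec_sub_le hb).trans ?_)
  have h1 := dotProduct_mulVec_le_zStar hσ (b - β)
  have h2 := mul_le_mul_of_nonneg_right hz (l1_nonneg (b - β))
  linarith

/-- The squared residuals along the lasso path. -/
lemma sq_sigmaStar_sub_le (hσ : 0 < sigmaStar X y β) {lam : ℝ} {b : Fin p → ℝ}
    (hb : ∀ b', (y - X *ᵥ b) ⬝ᵥ (X *ᵥ (b' - b)) / n ≤ lam * (l1 b' - l1 b)) (hlam : 0 ≤ lam) :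
    sigmaStar X y β ^ 2 - sigmaStar X y b ^ 2 ≤
      (sigmaStar X y β * zStar X y β + lam) * l1 (b - β) := by
  have h1 := dotProduct_mulVec_le_zStar hσ (b - β)
  have h2 := hb (b + (b - β))
  rw [add_sub_cancel_left] at h2
  have h3 : l1 (b + (b - β)) - l1 b ≤ l1 (b - β) := by
    have := l1_add_le b (b - β)
    linarith
  have h4 := mul_le_mul_of_nonneg_left h3 hlam
  have h5 : sigmaStar X y β ^ 2 - sigmaStar X y b ^ 2 =
      (y - X *ᵥ β) ⬝ᵥ (X *ᵥ (b - β)) / n + (y - X *ᵥ b) ⬝ᵥ (X *ᵥ (b - β)) / n := by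
    rw [sigmaStar_sq, sigmaStar_sq, ← sub_div, ← add_div]
    congr 1
    have : X *ᵥ (b - β) = (y - X *ᵥ β) - (y - X *ᵥ b) := by rw [mulVec_sub]; abel
    rw [this, l2_sq, l2_sq]
    generalize y - X *ᵥ β = v
    generalize y - X *ᵥ b = w
    rw [dotProduct_sub, dotProduct_sub, dotProduct_comm w v]
    ring
  rw [h5]
  linarith

/-- The noise level is not underestimated by more than a factor `1 - τ_*²`. -/
lemma IsScaledLasso.mul_sigmaStar_le (hlam0 : 0 < lam0) (hξ : 1 < ξ) (hσ : 0 < sigmaStar X y β)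
    {bhat : Fin p → ℝ} {shat : ℝ} (h : IsScaledLasso X y lam0 bhat shat)
    (hg : GoodEvent X y β lam0 ξ) (hτ : tauStar X y β lam0 ξ ^ 2 < 1) :
    (1 - tauStar X y β lam0 ξ ^ 2) * sigmaStar X y β ≤ shat := by
  have hn := pos_of_sigmaStar_pos hσ
  have hτeq := tauStar_sq X y β ξ hlam0.le
  have hτ0 : 0 ≤ tauStar X y β lam0 ξ ^ 2 := sq_nonneg _
  rw [GoodEvent] at hg
  set τ := tauStar X y β lam0 ξ ^ 2 with hτdef
  set σ := sigmaStar X y β with hσdef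
  have hμ : lam0 * mu X β (σ * lam0) ξ = τ * σ := by rw [hτeq]; field_simp
  -- Here `τ` stands for `τ_*²`. The good event is exactly the noise condition for the lasso with
  -- penalty `t * lam0`.
  set t := (1 - τ) * σ with ht
  have ht0 : 0 < t := mul_pos (by linarith) hσ
  obtain ⟨b₀, hb₀⟩ := exists_lasso X y (mul_pos ht0 hlam0)
  have hvar := lasso_variational hn (mul_pos ht0 hlam0).le hb₀
  have hz : σ * zStar X y β ≤ t * lam0 * (ξ - 1) / (ξ + 1) := by
    calc σ * zStar X y β ≤ σ * ((1 - τ) * lam0 * (ξ - 1) / (ξ + 1)) := by gcongr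
      _ = _ := by rw [ht]; ring
  have hl1 : l1 (b₀ - β) ≤ mu X β (σ * lam0) ξ := by
    refine (l1_sub_le_mu_of_variational hσ (mul_pos ht0 hlam0) hξ hz (hvar β)).trans ?_
    have := mu_le_mul_mu X β (lam := σ * lam0) (lam' := t * lam0) ξ le_rfl (by
      rw [one_mul]; gcongr; nlinarith)
    rwa [one_mul] at this
  have hξ1 : (ξ - 1) / (ξ + 1) < 1 := by rw [div_lt_one (by linarith)]; linarith
  have hz' : σ * zStar X y β < t * lam0 := by
    refine hz.trans_lt ?_
    rw [mul_div_assoc]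
    exact mul_lt_of_lt_one_right (mul_pos ht0 hlam0) hξ1
  -- The slope argument needs a residual level strictly above `t`, which may fail at `τ = 0`. In
  -- that case `μ = 0` forces `b₀ = β = 0`, and strict domination of the noise by the penalty forces
  -- `bhat = 0`.
  rcases hτ0.eq_or_lt with hτ00 | hτpos
  · -- `μ = 0`: the target vanishes and is recovered exactly
    have hmu0 : mu X β (σ * lam0) ξ = 0 := by
      have : lam0 * mu X β (σ * lam0) ξ = 0 := by rw [hμ, ← hτ00, zero_mul]
      exact (mul_eq_zero.1 this).resolve_left hlam0.ne'
    have hb : b₀ = β :=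
      sub_eq_zero.1 (l1_eq_zero (le_antisymm (hl1.trans hmu0.le) (l1_nonneg _)))
    have hβ : l1 β ≤ 0 := by
      have h1 := hvar 0
      rw [hb, zero_sub, l1_zero, mulVec_neg, dotProduct_neg] at h1
      have h2 := dotProduct_mulVec_le_zStar hσ β
      have h3 : (t * lam0 - σ * zStar X y β) * l1 β ≤ 0 := by
        rw [neg_div] at h1
        linarith
      by_contra hc
      push Not at hc
      exact absurd h3 (not_le.2 (mul_pos (by linarith) hc))
    have hβ0 : β = 0 := l1_eq_zero (le_antisymm hβ (l1_nonneg _))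
    have h1 := h.le_sqrtLoss hn β
    have h2 := sigmaStar_sub_le hσ bhat
    rw [← h.shat_eq hn] at h2
    have hsub : bhat - β = bhat := by rw [hβ0, sub_zero]
    rw [hsub] at h2
    rw [show l1 β = 0 by rw [hβ0, l1_zero]] at h1
    have htσ : t = σ := by rw [ht, ← hτ00]; ring
    rw [htσ, mul_lt_mul_iff_right₀ hσ] at hz'
    have h3 : (lam0 - zStar X y β) * l1 bhat ≤ 0 := by linarith
    have h4 : l1 bhat = 0 := by
      by_contra hc
      exact absurd h3 (not_le.2 (mul_pos (by linarith)
        ((l1_nonneg bhat).lt_of_ne (Ne.symm hc))))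
    rw [h4] at h2
    rw [htσ]
    linarith
  -- The loss of squared residual is at most `2 t τ σ`, and `σ² - 2 t τ σ` exceeds `t²` by `(σ τ)²`.
  · have hres : t ^ 2 < sigmaStar X y b₀ ^ 2 := by
      have h1 := sq_sigmaStar_sub_le hσ hvar (mul_pos ht0 hlam0).le
      have h2 : (σ * zStar X y β + t * lam0) * l1 (b₀ - β) ≤
          (2 * (t * lam0)) * mu X β (σ * lam0) ξ := by
        have hz0 := zStar_nonneg X y β
        have hl0 := l1_nonneg (b₀ - β)
        gcongr
        linarith
      have h3 : (2 * (t * lam0)) * mu X β (σ * lam0) ξ = 2 * t * (τ * σ) := by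
        rw [← hμ]; ring
      have h4 : σ ^ 2 - t ^ 2 - 2 * t * (τ * σ) = (σ * τ) ^ 2 := by rw [ht]; ring
      have : 0 < (σ * τ) ^ 2 := by positivity
      linarith
    by_contra hlt
    push Not at hlt
    -- If `shat < t`, the negative slope at `(b₀, t)` makes the loss at `(bhat, shat)` strictly
    -- larger than at `(b₀, t)`.
    have h1 := jointLoss_ge hn ht0 hvar h.1
    have h2 := h.2 b₀ t ⟨ht0.le, fun h' => absurd h' ht0.ne'⟩
    have h3 : 1 < (sigmaStar X y b₀ / t) ^ 2 := by
      rw [div_pow, one_lt_div (by positivity)]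
      exact hres
    have h4 : 0 < (shat - t) * ((1 - (sigmaStar X y b₀ / t) ^ 2) / 2) :=
      mul_pos_of_neg_of_neg (by linarith) (by linarith)
    linarith

/-- The oracle inequalities for a scaled lasso estimate. -/
theorem IsScaledLasso.oracle_inequality (hlam0 : 0 < lam0) (hξ : 1 < ξ)
    (hσ : 0 < sigmaStar X y β) {bhat : Fin p → ℝ} {shat : ℝ}
    (h : IsScaledLasso X y lam0 bhat shat) (hg : GoodEvent X y β lam0 ξ) :
    max (1 - shat / sigmaStar X y β) (1 - sigmaStar X y β / shat) ≤ tauStar X y β lam0 ξ ^ 2 ∧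
      (tauStar X y β lam0 ξ ^ 2 < 1 → 0 < shat ∧
        l1 (bhat - β) ≤
          mu X β (sigmaStar X y β * lam0) ξ / (1 - tauStar X y β lam0 ξ ^ 2)) := by
  have hn := pos_of_sigmaStar_pos hσ
  -- For `τ_* ≥ 1` the ratio bounds only say that the ratios are nonnegative.
  rcases le_or_gt 1 (tauStar X y β lam0 ξ ^ 2) with hτ | hτ
  · refine ⟨max_le ?_ ?_, fun h' => absurd h' (not_lt.2 hτ)⟩
    · have : 0 ≤ shat / sigmaStar X y β := div_nonneg h.1.1 hσ.le
      linarith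
    · have : 0 ≤ sigmaStar X y β / shat := div_nonneg hσ.le h.1.1
      linarith
  have hlow := h.mul_sigmaStar_le hlam0 hξ hσ hg hτ
  have hτeq := tauStar_sq X y β ξ hlam0.le
  have hτ0 : 0 ≤ tauStar X y β lam0 ξ ^ 2 := sq_nonneg _
  rw [GoodEvent] at hg
  set τ := tauStar X y β lam0 ξ ^ 2 with hτdef
  set σ := sigmaStar X y β with hσdef
  have hμ : lam0 * mu X β (σ * lam0) ξ = τ * σ := by rw [hτeq]; field_simp
  have hs0 : 0 < shat := (mul_pos (by linarith) hσ).trans_le hlow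
  have hl1 : l1 (bhat - β) ≤ mu X β (shat * lam0) ξ := by
    refine l1_sub_le_mu_of_variational hσ (mul_pos hs0 hlam0) hξ ?_ (h.variational hn hlam0.le β)
    have hξ1 : 0 ≤ (ξ - 1) / (ξ + 1) := div_nonneg (by linarith) (by linarith)
    calc σ * zStar X y β ≤ σ * ((1 - τ) * lam0 * (ξ - 1) / (ξ + 1)) := by gcongr
      _ = (1 - τ) * σ * (lam0 * ((ξ - 1) / (ξ + 1))) := by ring
      _ ≤ shat * (lam0 * ((ξ - 1) / (ξ + 1))) := by gcongr
      _ = _ := by ring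
  -- For `shat > σ`, comparing square root losses gives `shat - σ ≤ lam0 * l1 (bhat - β)`, and
  -- linear growth of `μ` bounds the right side by `shat * τ`.
  have hup : (1 - τ) * shat ≤ σ := by
    rcases le_or_gt shat σ with hle | hgt
    · nlinarith
    have h1 := h.le_sqrtLoss hn β
    have h2 : l1 β - l1 bhat ≤ l1 (bhat - β) := by
      rw [l1_sub_comm]; exact l1_sub_le β bhat
    have h3 : mu X β (shat * lam0) ξ ≤ shat / σ * mu X β (σ * lam0) ξ :=
      mu_le_mul_mu X β ξ ((one_le_div hσ).2 hgt.le) (by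
        have : shat / σ * (σ * lam0) = shat * lam0 := by field_simp
        rw [this])
    have h4 : lam0 * (l1 β - l1 bhat) ≤ lam0 * (shat / σ * mu X β (σ * lam0) ξ) := by
      gcongr
      exact h2.trans (hl1.trans h3)
    have h5 : lam0 * (shat / σ * mu X β (σ * lam0) ξ) = shat * τ := by
      calc _ = shat / σ * (lam0 * mu X β (σ * lam0) ξ) := by ring
        _ = _ := by rw [hμ]; field_simp
    linarith
  refine ⟨max_le ?_ ?_, fun _ => ⟨hs0, hl1.trans ?_⟩⟩
  · have := (le_div_iff₀ hσ).2 hlow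
    linarith
  · have := (le_div_iff₀ hs0).2 hup
    linarith
  · have h1 : 1 ≤ (1 - τ)⁻¹ := (one_le_inv₀ (by linarith)).2 (by linarith)
    have h2 := mu_le_mul_mu X β (lam := σ * lam0) (lam' := shat * lam0) ξ h1 (by
      rw [← mul_assoc]
      gcongr
      rw [← div_eq_inv_mul, le_div_iff₀ (by linarith)]
      linarith)
    rwa [← div_eq_inv_mul] at h2

end OracleInequality

end ScaledLasso

namespace ScaledLasso

/-! ### Tails of the Gaussian law and of the cosine of a Gaussian vector. -/

section GaussianTail

/-- The standard Gaussian law of `m` independent coordinates. -/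
noncomputable abbrev stdPi (m : ℕ) : Measure (Fin m → ℝ) := Measure.pi fun _ => gaussianReal 0 1

/-- On the tail `1 ≤ x / r`, and `x` times the density has an explicit primitive. -/
lemma gaussianReal_Ioi_le {r : ℝ} (hr : 0 < r) :
    gaussianReal 0 1 (Set.Ioi r) ≤ ENNReal.ofReal ((√(2 * Real.pi))⁻¹ * Real.exp (-(r ^ 2 / 2)) / r) := by
  set g : ℝ → ℝ := fun x => -((√(2 * Real.pi))⁻¹ * Real.exp (-(x ^ 2 / 2)) / r) with hg
  set g' : ℝ → ℝ := fun x => x / r * gaussianPDFReal 0 1 x with hg'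
  have hpdf : ∀ x, gaussianPDFReal 0 1 x = (√(2 * Real.pi))⁻¹ * Real.exp (-(x ^ 2 / 2)) := by
    intro x
    simp [gaussianPDFReal, neg_div]
  have hderiv : ∀ x, HasDerivAt g (g' x) x := by
    intro x
    have h1 : HasDerivAt (fun x : ℝ => -(x ^ 2 / 2)) (-x) x := by
      have := ((hasDerivAt_pow 2 x).div_const 2).neg
      convert! this using 1
      simp
    have h2 := (((h1.exp.const_mul (√(2 * Real.pi))⁻¹).div_const r)).neg
    convert! h2 using 1
    simp only [hg', hpdf]
    ring
  have hlim : Tendsto g atTop (𝓝 0) := by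
    have h1 : Tendsto (fun x : ℝ => -(x ^ 2 / 2)) atTop atBot :=
      tendsto_neg_atTop_atBot.comp ((tendsto_pow_atTop two_ne_zero).atTop_div_const two_pos)
    have h2 := (((Real.tendsto_exp_atBot.comp h1).const_mul (√(2 * Real.pi))⁻¹).div_const r).neg
    rwa [mul_zero, zero_div, neg_zero] at h2
  have hcont : ContinuousWithinAt g (Set.Ici r) r := (hderiv r).continuousAt.continuousWithinAt
  have hnn : ∀ x ∈ Set.Ioi r, 0 ≤ g' x := fun x hx =>
    mul_nonneg (div_nonneg (hr.trans hx).le hr.le) (gaussianPDFReal_nonneg _ _ _)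
  have hint := integral_Ioi_of_hasDerivAt_of_nonneg hcont (fun x _ => hderiv x) hnn hlim
  have hintble := integrableOn_Ioi_deriv_of_nonneg hcont (fun x _ => hderiv x) hnn hlim
  rw [gaussianReal_apply_eq_integral _ one_ne_zero]
  refine ENNReal.ofReal_le_ofReal ?_
  have : ∫ x in Set.Ioi r, gaussianPDFReal 0 1 x ≤ ∫ x in Set.Ioi r, g' x := by
    refine setIntegral_mono_on (integrable_gaussianPDFReal 0 1).integrableOn hintble
      measurableSet_Ioi fun x hx => ?_
    have : 1 ≤ x / r := (one_le_div hr).2 (le_of_lt hx)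
    exact le_mul_of_one_le_left (gaussianPDFReal_nonneg _ _ _) this
  refine this.trans (hint.le.trans ?_)
  simp [hg]

/-- Mills' bound for the two-sided tail of the standard normal distribution. -/
lemma gaussianReal_abs_gt_le {r : ℝ} (hr : 0 < r) :
    gaussianReal 0 1 {x | r < |x|} ≤
      ENNReal.ofReal (2 * (√(2 * Real.pi))⁻¹ * (Real.exp (-(r ^ 2 / 2)) / r)) := by
  have h1 : {x : ℝ | r < |x|} ⊆ Set.Ioi r ∪ (fun x => -x) ⁻¹' Set.Ioi r := fun x hx => by
    rcases lt_abs.1 (Set.mem_ofPred_eq ▸ hx) with h | h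
    · exact .inl h
    · exact .inr h
  have h2 : gaussianReal 0 1 ((fun x => -x) ⁻¹' Set.Ioi r) = gaussianReal 0 1 (Set.Ioi r) := by
    rw [← Measure.map_apply measurable_neg measurableSet_Ioi, gaussianReal_map_neg, neg_zero]
  refine (measure_mono h1).trans ((measure_union_le _ _).trans ?_)
  rw [h2]
  refine (add_le_add (gaussianReal_Ioi_le hr) (gaussianReal_Ioi_le hr)).trans ?_
  rw [← ENNReal.ofReal_add (by positivity) (by positivity)]
  exact ENNReal.ofReal_le_ofReal (by apply le_of_eq; ring)

lemma integral_exp_neg_sq_gaussianReal {s : ℝ} (hs : 0 ≤ s) :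
    ∫ x, Real.exp (-(s * x ^ 2 / 2)) ∂(gaussianReal 0 1) = (1 + s) ^ (-(1 / 2) : ℝ) := by
  have hs' : 0 < 1 + s := by linarith
  rw [integral_gaussianReal_eq_integral_smul one_ne_zero]
  have h1 : ∀ x : ℝ, gaussianPDFReal 0 1 x • Real.exp (-(s * x ^ 2 / 2)) =
      (√(2 * Real.pi))⁻¹ * Real.exp (-((1 + s) / 2) * x ^ 2) := by
    intro x
    have : gaussianPDFReal 0 1 x = (√(2 * Real.pi))⁻¹ * Real.exp (-(x ^ 2 / 2)) := by
      simp [gaussianPDFReal, neg_div]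
    rw [this, smul_eq_mul, mul_assoc, ← Real.exp_add]
    ring_nf
  simp_rw [h1]
  rw [integral_const_mul, integral_gaussian, Real.rpow_neg hs'.le, ← Real.sqrt_eq_rpow,
    ← Real.sqrt_inv, ← Real.sqrt_inv, ← Real.sqrt_mul (by positivity)]
  congr 1
  field_simp

/-- The Laplace transform of the chi-square distribution. -/
lemma lintegral_exp_neg_sum_sq {s : ℝ} (hs : 0 ≤ s) (m : ℕ) :
    ∫⁻ x, ENNReal.ofReal (Real.exp (-(s * (∑ i, x i ^ 2) / 2))) ∂(stdPi m) =
      ENNReal.ofReal ((1 + s) ^ (-(m / 2) : ℝ)) := by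
  have hs' : 0 < 1 + s := by linarith
  have h1 : ∀ x : Fin m → ℝ, Real.exp (-(s * (∑ i, x i ^ 2) / 2)) =
      ∏ i, Real.exp (-(s * x i ^ 2 / 2)) := by
    intro x
    rw [← Real.exp_sum, Finset.mul_sum, Finset.sum_div, Finset.sum_neg_distrib]
  rw [← ofReal_integral_eq_lintegral_ofReal]
  · simp_rw [h1]
    rw [integral_fintype_prod_eq_pow (fun x : ℝ => Real.exp (-(s * x ^ 2 / 2))),
      integral_exp_neg_sq_gaussianReal hs, Fintype.card_fin, ← Real.rpow_natCast,
      ← Real.rpow_mul hs'.le]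
    congr 2
    ring
  · refine Integrable.of_bound (Measurable.aestronglyMeasurable (by fun_prop)) 1 (ae_of_all _ fun x => ?_)
    rw [Real.norm_eq_abs, Real.abs_exp, Real.exp_le_one_iff, neg_nonpos]
    exact div_nonneg (mul_nonneg hs (Finset.sum_nonneg fun _ _ => sq_nonneg _)) two_pos.le
  · exact ae_of_all _ fun x => (Real.exp_pos _).le

/-- Writes `exp (-k Q / 2) / Q` as a mixture of exponentials, so that its expectation for chi-square
`Q` follows from the Laplace transform by Tonelli's theorem. -/
lemma lintegral_Ioi_exp_neg {k Q : ℝ} (hQ : 0 < Q) :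
    ∫⁻ s in Set.Ioi k, ENNReal.ofReal (Real.exp (-(s * Q / 2)) / 2) =
      ENNReal.ofReal (Real.exp (-(k * Q / 2)) / Q) := by
  have ha : -(Q / 2) < 0 := by linarith
  have h1 : ∀ s, Real.exp (-(s * Q / 2)) / 2 = Real.exp (-(Q / 2) * s) / 2 := by
    intro s; ring_nf
  simp_rw [h1]
  rw [← ofReal_integral_eq_lintegral_ofReal]
  · rw [integral_div, integral_exp_mul_Ioi ha]
    congr 1
    have : -(Q / 2) * k = -(k * Q / 2) := by ring
    rw [this]
    field_simp
  · exact (integrableOn_exp_mul_Ioi ha k).div_const 2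
  · exact ae_of_all _ fun x => by positivity

lemma lintegral_Ioi_one_add_rpow {k : ℝ} (hk : 0 ≤ k) {d : ℝ} (hd : 2 < d) :
    ∫⁻ s in Set.Ioi k, ENNReal.ofReal ((1 + s) ^ (-(d / 2)) / 2) =
      ENNReal.ofReal ((1 + k) ^ (1 - d / 2) / (d - 2)) := by
  set g : ℝ → ℝ := fun s => -((1 + s) ^ (1 - d / 2) / (d - 2)) with hg
  have hderiv : ∀ s ∈ Set.Ici k, HasDerivAt g ((1 + s) ^ (-(d / 2)) / 2) s := by
    intro s hs
    have hs' : 0 < 1 + s := by have : k ≤ s := hs; linarith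
    have h1 : HasDerivAt (fun s : ℝ => 1 + s) 1 s := (hasDerivAt_id s).const_add 1
    have h2 := ((h1.rpow_const (p := 1 - d / 2) (.inl hs'.ne')).div_const (d - 2)).neg
    convert! h2 using 1
    have e : 1 - d / 2 - 1 = -(d / 2) := by ring
    rw [e]
    have : d - 2 ≠ 0 := by linarith
    field_simp
    ring
  have hcont : ContinuousWithinAt g (Set.Ici k) k :=
    (hderiv k Set.self_mem_Ici).continuousAt.continuousWithinAt
  have hnn : ∀ s ∈ Set.Ioi k, 0 ≤ (1 + s) ^ (-(d / 2)) / 2 := fun s hs => by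
    have : 0 < 1 + s := by have : k < s := hs; linarith
    positivity
  have hlim : Tendsto g atTop (𝓝 0) := by
    have h1 : Tendsto (fun s : ℝ => (1 + s) ^ (-(d / 2 - 1))) atTop (𝓝 0) :=
      (tendsto_rpow_neg_atTop (by linarith : 0 < d / 2 - 1)).comp
        (tendsto_atTop_add_const_left _ _ tendsto_id)
    have h2 := (h1.div_const (d - 2)).neg
    simp only [zero_div, neg_zero, neg_sub] at h2
    exact h2
  have hd' : ∀ s ∈ Set.Ioi k, HasDerivAt g ((1 + s) ^ (-(d / 2)) / 2) s :=
    fun s hs => hderiv s (Set.Ioi_subset_Ici_self hs)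
  rw [← ofReal_integral_eq_lintegral_ofReal
    (integrableOn_Ioi_deriv_of_nonneg hcont hd' hnn hlim)
    ((ae_restrict_iff' measurableSet_Ioi).2 (ae_of_all _ hnn)),
    integral_Ioi_of_hasDerivAt_of_nonneg hcont hd' hnn hlim]
  simp [hg]

/-- A tail bound for Student's `t` distribution. -/
lemma stdPi_sq_lt_sq_le {m : ℕ} (hm : 2 < m) {k : ℝ} (hk : 0 < k) :
    stdPi (m + 1) {x | k * ∑ i : Fin m, x i.succ ^ 2 < x 0 ^ 2} ≤
      ENNReal.ofReal (2 * (√(2 * Real.pi))⁻¹ / √k *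
        ((1 + k) ^ (-((m - 1) / 2) : ℝ) / √((m : ℝ) - 2))) := by
  have hm' : (2 : ℝ) < m := by exact_mod_cast hm
  have hk1 : 0 < 1 + k := by linarith
  set c : ℝ := 2 * (√(2 * Real.pi))⁻¹ / √k with hc
  have hc0 : 0 < c := by positivity
  -- Given the other coordinates, Mills' bound produces a factor `1 / √Q`. It is replaced by `(a / Q
  -- + 1 / a) / 2`, whose expectation against `exp (-k Q / 2)` is explicit. This `a` balances the
  -- two resulting terms.
  set a : ℝ := √((m - 2) / (1 + k)) with ha
  have ha0 : 0 < a := Real.sqrt_pos.2 (div_pos (by linarith) hk1)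
  have ha2 : a ^ 2 = (m - 2) / (1 + k) := Real.sq_sqrt (div_nonneg (by linarith) hk1.le)
  set Q : (Fin m → ℝ) → ℝ := fun x => ∑ i, x i ^ 2 with hQ
  have hQm : Measurable Q := by fun_prop
  have hpt : ∀ z : Fin m → ℝ, gaussianReal 0 1 {x | k * Q z < x ^ 2} ≤
      ENNReal.ofReal (c * a / 2) * (∫⁻ s in Set.Ioi k, ENNReal.ofReal (Real.exp (-(s * Q z / 2)) / 2)) +
      ENNReal.ofReal (c / (2 * a)) * ENNReal.ofReal (Real.exp (-(k * Q z / 2))) := by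
    intro z
    have hQ0 : 0 ≤ Q z := Finset.sum_nonneg fun _ _ => sq_nonneg _
    rcases hQ0.eq_or_lt with h0 | h0
    -- At `Q = 0` the right side is infinite, being an integral of a positive constant over a ray.
    · rw [← h0]
      simp only [mul_zero, zero_div, neg_zero, Real.exp_zero, lintegral_const]
      rw [Measure.restrict_apply_univ, Real.volume_Ioi, ENNReal.mul_top (by simp),
        ENNReal.mul_top (by simpa using by positivity), top_add]
      exact le_top
    · rw [lintegral_Ioi_exp_neg h0, ← ENNReal.ofReal_mul (by positivity),
        ← ENNReal.ofReal_mul (by positivity), ← ENNReal.ofReal_add (by positivity) (by positivity)]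
      have hset : {x : ℝ | k * Q z < x ^ 2} = {x | √(k * Q z) < |x|} := by
        ext x
        simp only [Set.mem_ofPred_eq]
        rw [← Real.sqrt_sq_eq_abs, Real.sqrt_lt_sqrt_iff (by positivity)]
      rw [hset]
      refine (gaussianReal_abs_gt_le (Real.sqrt_pos.2 (mul_pos hk h0))).trans
        (ENNReal.ofReal_le_ofReal ?_)
      rw [Real.sq_sqrt (by positivity), Real.sqrt_mul hk.le]
      have hsq : 0 < √(Q z) := Real.sqrt_pos.2 h0
      have e1 : 2 * (√(2 * Real.pi))⁻¹ * (Real.exp (-(k * Q z / 2)) / (√k * √(Q z))) =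
          c * Real.exp (-(k * Q z / 2)) * (1 / √(Q z)) := by
        rw [hc]; field_simp
      have e2 : c * a / 2 * (Real.exp (-(k * Q z / 2)) / Q z) +
          c / (2 * a) * Real.exp (-(k * Q z / 2)) =
          c * Real.exp (-(k * Q z / 2)) * ((a / Q z + 1 / a) / 2) := by
        field_simp
      rw [e1, e2]
      refine mul_le_mul_of_nonneg_left ?_ (by positivity)
      have e3 : a / Q z = a * (1 / √(Q z)) ^ 2 := by
        rw [div_pow, Real.sq_sqrt h0.le]; ring
      rw [e3]
      have e4 : 0 ≤ a * (1 / √(Q z) - 1 / a) ^ 2 := by positivity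
      have e5 : a * (1 / √(Q z) - 1 / a) ^ 2 =
          a * (1 / √(Q z)) ^ 2 + 1 / a - 2 * (1 / √(Q z)) := by
        field_simp
        ring
      linarith
  have hswap : ∫⁻ z, (∫⁻ s in Set.Ioi k, ENNReal.ofReal (Real.exp (-(s * Q z / 2)) / 2)) ∂(stdPi m) =
      ENNReal.ofReal ((1 + k) ^ (1 - (m : ℝ) / 2) / (m - 2)) := by
    rw [lintegral_lintegral_swap (by fun_prop), ← lintegral_Ioi_one_add_rpow hk.le hm']
    refine setLIntegral_congr_fun measurableSet_Ioi fun s hs => ?_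
    have hs0 : 0 ≤ s := hk.le.trans (le_of_lt hs)
    have hs1 : 0 < 1 + s := by linarith
    simp only [div_eq_mul_inv _ (2 : ℝ)]
    simp_rw [ENNReal.ofReal_mul (Real.exp_pos _).le]
    rw [lintegral_mul_const _ (by fun_prop), ENNReal.ofReal_mul (by positivity)]
    congr 1
    have := lintegral_exp_neg_sum_sq hs0 m
    simp only [div_eq_mul_inv _ (2 : ℝ)] at this
    exact this
  have hmp := measurePreserving_piFinSuccAbove (fun _ : Fin (m + 1) => gaussianReal 0 1) 0
  have hms : MeasurableSet {q : ℝ × (Fin m → ℝ) | k * Q q.2 < q.1 ^ 2} :=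
    measurableSet_lt (by fun_prop) (by fun_prop)
  have hpre : {x : Fin (m + 1) → ℝ | k * ∑ i : Fin m, x i.succ ^ 2 < x 0 ^ 2} =
      (MeasurableEquiv.piFinSuccAbove (fun _ : Fin (m + 1) => ℝ) 0) ⁻¹'
        {q : ℝ × (Fin m → ℝ) | k * Q q.2 < q.1 ^ 2} := by
    ext x
    simp [hQ, MeasurableEquiv.piFinSuccAbove, Fin.tail]
  rw [hpre, hmp.measure_preimage hms.nullMeasurableSet, Measure.prod_apply_symm hms]
  refine (lintegral_mono hpt).trans ?_
  rw [lintegral_add_right _ (by fun_prop), lintegral_const_mul _ (by fun_prop),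
    lintegral_const_mul _ (by fun_prop), hswap, lintegral_exp_neg_sum_sq hk.le,
    ← ENNReal.ofReal_mul (by positivity), ← ENNReal.ofReal_mul (by positivity),
    ← ENNReal.ofReal_add (by have : 0 < (m : ℝ) - 2 := by linarith
                             positivity) (by positivity)]
  refine ENNReal.ofReal_le_ofReal (le_of_eq ?_)
  have hm2 : 0 < (m : ℝ) - 2 := by linarith
  have e1 : (1 + k) ^ (1 - (m : ℝ) / 2) = (1 + k) * (1 + k) ^ (-((m : ℝ) / 2)) := by
    rw [sub_eq_add_neg, Real.rpow_add hk1, Real.rpow_one]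
  have e2 : (1 + k) ^ (-(((m : ℝ) - 1) / 2)) = √(1 + k) * (1 + k) ^ (-((m : ℝ) / 2)) := by
    rw [Real.sqrt_eq_rpow, ← Real.rpow_add hk1]
    ring_nf
  rw [e1, e2]
  generalize (1 + k) ^ (-((m : ℝ) / 2)) = w
  have e3 : a = √((m : ℝ) - 2) / √(1 + k) := by rw [ha, Real.sqrt_div hm2.le]
  have e4 : √((m : ℝ) - 2) ^ 2 = m - 2 := Real.sq_sqrt hm2.le
  have e5 : √(1 + k) ^ 2 = 1 + k := Real.sq_sqrt hk1.le
  have e6 : 0 < √((m : ℝ) - 2) := Real.sqrt_pos.2 hm2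
  have e7 : 0 < √(1 + k) := Real.sqrt_pos.2 hk1
  rw [e3]
  generalize √((m : ℝ) - 2) = A at e4 e6 ⊢
  generalize √(1 + k) = B at e5 e7 ⊢
  rw [← e4, ← e5]
  field_simp
  ring

lemma lt_abs_coordinate_iff {m : ℕ} {u : ℝ} (hu0 : 0 < u) (hu1 : u < 1) (x : Fin (m + 1) → ℝ) :
    u * l2 x < |x 0| ↔ u ^ 2 / (1 - u ^ 2) * ∑ i : Fin m, x i.succ ^ 2 < x 0 ^ 2 := by
  have h1 : 0 < 1 - u ^ 2 := by nlinarith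
  rw [← abs_of_nonneg (mul_nonneg hu0.le (l2_nonneg x)), ← sq_lt_sq, mul_pow, l2_sq_eq_sum,
    Fin.sum_univ_succ, div_mul_eq_mul_div, div_lt_iff₀ h1]
  constructor <;> intro h <;> linarith

/-- The distribution of the cosine of the angle with a Gaussian vector does not depend on the
direction. -/
lemma stdPi_lt_abs_dotProduct {m : ℕ} {v : Fin (m + 1) → ℝ} (hv : l2 v = 1) (u : ℝ) :
    stdPi (m + 1) {x | u * l2 x < |v ⬝ᵥ x|} = stdPi (m + 1) {x | u * l2 x < |x 0|} := by
  have hnorm : ∀ w : EuclideanSpace ℝ (Fin (m + 1)), ‖w‖ = l2 w := by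
    intro w
    rw [EuclideanSpace.norm_eq, l2]
    simp
  set v' : EuclideanSpace ℝ (Fin (m + 1)) := WithLp.toLp 2 v with hv'
  -- The standard Gaussian has independent standard coordinates in every orthonormal basis, in
  -- particular in one starting with `v`.
  obtain ⟨b, hb⟩ : ∃ b : OrthonormalBasis (Fin (m + 1)) ℝ (EuclideanSpace ℝ (Fin (m + 1))),
      ∀ i ∈ ({0} : Set (Fin (m + 1))), b i = (fun _ => v') i := by
    refine Orthonormal.exists_orthonormalBasis_extension_of_card_eq (by simp) ?_
    refine ⟨fun i => ?_, fun i j hij => absurd (Subsingleton.elim i j) hij⟩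
    simp [Set.domRestrict, hnorm, hv', hv]
  have hb0 : b 0 = v' := hb 0 rfl
  set S : Set (EuclideanSpace ℝ (Fin (m + 1))) := {w | u * ‖w‖ < |inner ℝ v' w|} with hS
  have hSm : MeasurableSet S := measurableSet_lt (by fun_prop) (by fun_prop)
  have e1 : stdPi (m + 1) {x | u * l2 x < |v ⬝ᵥ x|} =
      stdGaussian (EuclideanSpace ℝ (Fin (m + 1))) S := by
    rw [← map_pi_eq_stdGaussian, Measure.map_apply (by fun_prop) hSm]
    congr 1
    ext x
    simp only [Set.mem_ofPred_eq, Set.mem_preimage, hS, hnorm]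
    rw [hv', EuclideanSpace.inner_toLp_toLp]
    simp [dotProduct_comm]
  have e2 : stdPi (m + 1) {x | u * l2 x < |x 0|} =
      stdGaussian (EuclideanSpace ℝ (Fin (m + 1))) S := by
    rw [stdGaussian_eq_map_pi_orthonormalBasis b, Measure.map_apply (by fun_prop) hSm]
    congr 1
    ext x
    simp only [Set.mem_ofPred_eq, Set.mem_preimage, hS]
    have h1 : inner ℝ v' (∑ i, x i • b i) = x 0 := by
      rw [← hb0, b.orthonormal.inner_right_fintype]
    have h2 : ‖∑ i, x i • b i‖ = l2 x := by
      have : ∑ i, x i • b i = b.repr.symm (WithLp.toLp 2 x) := by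
        rw [← b.sum_repr_symm]
      rw [this, LinearIsometryEquiv.norm_map, hnorm]
    rw [h1, h2]
  rw [e1, e2]

/-- Tail bound for the cosine of the angle between a fixed direction and a Gaussian vector. -/
lemma stdPi_lt_abs_dotProduct_le {n : ℕ} (hn : 3 < n) {v : Fin n → ℝ} (hv : l2 v = 1) {u : ℝ}
    (hu0 : 0 < u) (hu1 : u < 1) :
    stdPi n {x | u * l2 x < |v ⬝ᵥ x|} ≤ ENNReal.ofReal (2 * (√(2 * Real.pi))⁻¹ / u *
      ((1 - u ^ 2) ^ (((n : ℝ) - 1) / 2) / √((n : ℝ) - 3))) := by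
  obtain ⟨m, rfl⟩ : ∃ m, n = m + 1 := ⟨n - 1, by omega⟩
  have h1 : 0 < 1 - u ^ 2 := by nlinarith
  rw [stdPi_lt_abs_dotProduct hv]
  simp_rw [lt_abs_coordinate_iff hu0 hu1]
  refine (stdPi_sq_lt_sq_le (by omega) (by positivity)).trans (ENNReal.ofReal_le_ofReal ?_)
  -- The factor `1 / √k` contributes `√(1 - u²)`, which raises the exponent from `(n - 2) / 2` to
  -- `(n - 1) / 2`.
  have e1 : 1 + u ^ 2 / (1 - u ^ 2) = (1 - u ^ 2)⁻¹ := by field_simp; ring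
  have e2 : √(u ^ 2 / (1 - u ^ 2)) = u / √(1 - u ^ 2) := by
    rw [Real.sqrt_div (sq_nonneg u), Real.sqrt_sq hu0.le]
  have e3 : ((m + 1 : ℕ) : ℝ) - 3 = m - 2 := by push_cast; ring
  have e4 : (1 - u ^ 2) ^ ((((m + 1 : ℕ) : ℝ) - 1) / 2) =
      √(1 - u ^ 2) * (1 - u ^ 2) ^ (((m : ℝ) - 1) / 2) := by
    rw [Real.sqrt_eq_rpow, ← Real.rpow_add h1]
    push_cast
    ring_nf
  rw [e1, e2, e3, e4, Real.inv_rpow h1.le, Real.rpow_neg h1.le, inv_inv]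
  apply le_of_eq
  have : 0 < √(1 - u ^ 2) := Real.sqrt_pos.2 h1
  field_simp

end GaussianTail

end ScaledLasso

namespace ScaledLasso

variable {n p : ℕ} {X : Matrix (Fin n) (Fin p) ℝ}

/-! ### The union bound for `z*` and the uniform probability bound. -/

section ProbabilityBound

lemma pr_eq_map_stdPi (X : Matrix (Fin n) (Fin p) ℝ) (β : Fin p → ℝ) (σ : ℝ) :
    pr X β σ = (stdPi n).map fun g => X *ᵥ β + σ • g := by
  have h1 : gaussianReal 0 (Real.toNNReal (σ ^ 2)) = (gaussianReal 0 1).map (fun x => σ * x) := by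
    rw [gaussianReal_map_const_mul, mul_zero, mul_one]
    congr 1
    ext
    simp [sq_nonneg]
  have h2 : (Measure.pi fun _ : Fin n => gaussianReal 0 (Real.toNNReal (σ ^ 2))) =
      (stdPi n).map fun g => σ • g := by
    rw [h1]
    have : ∀ _ : Fin n, SigmaFinite ((gaussianReal 0 1).map fun x => σ * x) := fun _ =>
      have := Measure.isProbabilityMeasure_map (μ := gaussianReal 0 1) (f := fun x => σ * x)
        (by fun_prop)
      inferInstance
    exact (Measure.pi_map_pi (f := fun _ x => σ * x) (fun _ => by fun_prop)).symm
  rw [pr, h2, Measure.map_map (by fun_prop) (by fun_prop)]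
  rfl

/-- The normalized `j`-th column of the design. -/
noncomputable def unitCol (X : Matrix (Fin n) (Fin p) ℝ) (j : Fin p) : Fin n → ℝ :=
  (√(n : ℝ))⁻¹ • fun i => X i j

lemma l2_smul {m : ℕ} (c : ℝ) (v : Fin m → ℝ) : l2 (c • v) = |c| * l2 v := by
  rw [l2, l2, ← Real.sqrt_sq_eq_abs, ← Real.sqrt_mul (sq_nonneg c), Finset.mul_sum]
  simp [mul_pow]

lemma l2_unitCol (hn : 0 < n) (hX : ColumnsNormalized X) (j : Fin p) : l2 (unitCol X j) = 1 := by
  have hn' : (0 : ℝ) < n := by exact_mod_cast hn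
  rw [unitCol, l2_smul, l2, hX j, abs_of_pos (by positivity)]
  exact inv_mul_cancel₀ (Real.sqrt_pos.2 hn').ne'

lemma sigmaStar_add_smul (β : Fin p → ℝ) {σ : ℝ} (hσ : 0 < σ) (g : Fin n → ℝ) :
    sigmaStar X (X *ᵥ β + σ • g) β = σ * (l2 g / √n) := by
  rw [sigmaStar, add_sub_cancel_left, l2_smul, abs_of_pos hσ, mul_div_assoc]

/-- Numerator and denominator of `z*` are both proportional to `σ`; the quotient is the largest
absolute cosine between `g` and the columns. -/
lemma zStar_le_of_forall (hn : 0 < n) (β : Fin p → ℝ) {σ u : ℝ} (hσ : 0 < σ) (hu : 0 ≤ u)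
    {g : Fin n → ℝ} (h : ∀ j, |unitCol X j ⬝ᵥ g| ≤ u * l2 g) :
    zStar X (X *ᵥ β + σ • g) β ≤ u := by
  have hn' : (0 : ℝ) < n := by exact_mod_cast hn
  have hsn : 0 < √(n : ℝ) := Real.sqrt_pos.2 hn'
  refine div_le_of_le_mul₀ (sigmaStar_nonneg _ _ _) hu ?_
  rw [sigmaStar_add_smul β hσ, add_sub_cancel_left]
  have hl := l2_nonneg g
  refine (pi_norm_le_iff_of_nonneg (by positivity)).2 fun j => ?_
  have e1 : ((n : ℝ)⁻¹ • (Xᵀ *ᵥ (σ • g))) j = σ / √n * (unitCol X j ⬝ᵥ g) := by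
    rw [unitCol, smul_dotProduct, mulVec_smul, Pi.smul_apply, Pi.smul_apply, smul_eq_mul,
      smul_eq_mul, smul_eq_mul]
    have e2 : (Xᵀ *ᵥ g) j = (fun i => X i j) ⬝ᵥ g := rfl
    have e3 : (n : ℝ) = √n * √n := (Real.mul_self_sqrt hn'.le).symm
    rw [e2]
    generalize (fun i => X i j) ⬝ᵥ g = w
    rw [e3, Real.sqrt_mul_self hsn.le]
    field_simp
  rw [e1, Real.norm_eq_abs, abs_mul, abs_of_pos (by positivity)]
  calc σ / √n * |unitCol X j ⬝ᵥ g| ≤ σ / √n * (u * l2 g) := by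
        gcongr
        exact h j
    _ = _ := by ring

lemma one_sub_le_exp {x : ℝ} (h0 : 0 ≤ x) (h1 : x < 1) : 1 - x ≤ Real.exp (-(x + x ^ 2 / 2)) := by
  have hs := Real.hasSum_pow_div_log_of_abs_lt_one (abs_lt.2 ⟨by linarith, h1⟩)
  have := sum_le_hasSum (Finset.range 2) (fun i _ => by positivity) hs
  simp only [Finset.sum_range_succ, Finset.sum_range_zero] at this
  norm_num at this
  rw [← Real.log_le_iff_le_exp (by linarith)]
  linarith

/-- The exponent `(n - 1) / 2` in place of `n / 2` costs a factor `exp (L / n)`. The second order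
term of the logarithm pays for it once `L (n - 1) ≥ n`, which `L ≥ 2` ensures. -/
lemma one_sub_rpow_le_exp {n : ℕ} {L : ℝ} (hn : 3 < n) (hL : 2 ≤ L) (hLn : 2 * L / n < 1) :
    (1 - 2 * L / n) ^ (((n : ℝ) - 1) / 2) ≤ Real.exp (-L) := by
  have hn' : (3 : ℝ) < n := by exact_mod_cast hn
  have hx0 : 0 ≤ 2 * L / n := by positivity
  calc (1 - 2 * L / n) ^ (((n : ℝ) - 1) / 2)
      ≤ Real.exp (-(2 * L / n + (2 * L / n) ^ 2 / 2)) ^ (((n : ℝ) - 1) / 2) :=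
        Real.rpow_le_rpow (by linarith) (one_sub_le_exp hx0 hLn) (by linarith)
    _ = Real.exp (-(2 * L / n + (2 * L / n) ^ 2 / 2) * (((n : ℝ) - 1) / 2)) := by
        rw [← Real.exp_mul]
    _ ≤ _ := by
        refine Real.exp_le_exp.2 ?_
        have e : -(2 * L / n + (2 * L / n) ^ 2 / 2) * (((n : ℝ) - 1) / 2) + L =
            -(L / n ^ 2 * (L * (n - 1) - n)) := by
          field_simp
          ring
        have h1 : 0 ≤ L * ((n : ℝ) - 1) - n := by nlinarith
        have h2 : 0 ≤ L / n ^ 2 * (L * ((n : ℝ) - 1) - n) := by positivity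
        linarith

lemma stdPi_unitCol_le (hn : 3 < n) (hX : ColumnsNormalized X) {L : ℝ} (hL : 2 ≤ L)
    (j : Fin p) : stdPi n {g | √(2 * L / n) * l2 g < |unitCol X j ⬝ᵥ g|} ≤
      ENNReal.ofReal (√((n : ℝ) / (n - 3)) * Real.exp (-L) / √(Real.pi * L)) := by
  have hn' : (3 : ℝ) < n := by exact_mod_cast hn
  have hv := l2_unitCol (by omega) hX j
  have hu0 : 0 < √(2 * L / n) := Real.sqrt_pos.2 (by positivity)
  rcases lt_or_ge (2 * L / n) 1 with hu | hu
  · refine (stdPi_lt_abs_dotProduct_le hn hv hu0 (by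
      rw [Real.sqrt_lt' one_pos]; linarith)).trans (ENNReal.ofReal_le_ofReal ?_)
    rw [Real.sq_sqrt (by positivity)]
    have h3 : 0 < √((n : ℝ) - 3) := Real.sqrt_pos.2 (by linarith)
    have e1 : 2 * (√(2 * Real.pi))⁻¹ / √(2 * L / n) = √n / √(Real.pi * L) := by
      rw [Real.sqrt_div (by positivity), Real.sqrt_mul two_pos.le, Real.sqrt_mul two_pos.le,
        Real.sqrt_mul Real.pi_pos.le]
      have : √(2 : ℝ) * √2 = 2 := Real.mul_self_sqrt two_pos.le
      have hp : 0 < √Real.pi := Real.sqrt_pos.2 Real.pi_pos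
      have hL' : 0 < √L := Real.sqrt_pos.2 (by linarith)
      field_simp
      linarith
    rw [e1, Real.sqrt_div (by positivity)]
    calc √n / √(Real.pi * L) * ((1 - 2 * L / n) ^ (((n : ℝ) - 1) / 2) / √((n : ℝ) - 3))
        ≤ √n / √(Real.pi * L) * (Real.exp (-L) / √((n : ℝ) - 3)) := by
          gcongr
          exact one_sub_rpow_le_exp hn hL hu
      _ = _ := by ring
  -- An absolute cosine never exceeds one.
  · have : {g : Fin n → ℝ | √(2 * L / n) * l2 g < |unitCol X j ⬝ᵥ g|} = ∅ := by
      rw [Set.eq_empty_iff_forall_notMem]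
      intro g hg
      have h1 : |unitCol X j ⬝ᵥ g| ≤ l2 g := by
        refine abs_le_of_sq_le_sq ?_ (l2_nonneg g)
        have := sq_dotProduct_le (unitCol X j) g
        rwa [hv, one_pow, one_mul] at this
      have h2 : l2 g ≤ √(2 * L / n) * l2 g :=
        le_mul_of_one_le_left (l2_nonneg g) (Real.one_le_sqrt.2 hu)
      exact not_lt.2 (h1.trans h2) hg
    rw [this, measure_empty]
    exact zero_le

/-- The tail bound for the maximal correlation of the noise with the design. -/
lemma stdPi_zStar_gt_le (hn : 3 < n) (hX : ColumnsNormalized X) (β : Fin p → ℝ) {σ L : ℝ}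
    (hσ : 0 < σ) (hL : 2 ≤ L) :
    (stdPi n).real {g | ¬ zStar X (X *ᵥ β + σ • g) β ≤ √(2 * L / n)} ≤
      p * (√((n : ℝ) / (n - 3)) * Real.exp (-L) / √(Real.pi * L)) := by
  refine ENNReal.toReal_le_of_le_ofReal (by positivity) ?_
  have hsub : {g | ¬ zStar X (X *ᵥ β + σ • g) β ≤ √(2 * L / n)} ⊆
      ⋃ j : Fin p, {g : Fin n → ℝ | √(2 * L / n) * l2 g < |unitCol X j ⬝ᵥ g|} := by
    intro g hg
    by_contra hc
    simp only [Set.mem_iUnion, Set.mem_ofPred_eq, not_exists, not_lt] at hc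
    exact hg (zStar_le_of_forall (by omega) β hσ (Real.sqrt_nonneg _) hc)
  refine (measure_mono hsub).trans ((measure_iUnion_fintype_le _ _).trans ?_)
  refine (Finset.sum_le_sum fun j _ => stdPi_unitCol_le hn hX hL j).trans ?_
  rw [Finset.sum_const, Finset.card_univ, Fintype.card_fin, nsmul_eq_mul,
    ENNReal.ofReal_mul (by positivity), ENNReal.ofReal_natCast]

/-- Works for arbitrary sets, with outer measures: `Measure.le_map_apply` and subadditivity need no
measurability. -/
lemma one_sub_le_pr_real {β : Fin p → ℝ} {σ : ℝ} {S : Set (Fin n → ℝ)} {q : ℝ}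
    {B : Set (Fin n → ℝ)} (hB : (stdPi n).real B ≤ q) (hS : ∀ g, g ∉ B → X *ᵥ β + σ • g ∈ S) :
    1 - q ≤ (pr X β σ).real S := by
  have h1 : (stdPi n).real ((fun g => X *ᵥ β + σ • g) ⁻¹' S) ≤ (pr X β σ).real S := by
    rw [pr_eq_map_stdPi]
    refine ENNReal.toReal_mono ?_ (Measure.le_map_apply (by fun_prop) S)
    rw [← pr_eq_map_stdPi]
    exact measure_ne_top _ _
  have h2 : (stdPi n).real Set.univ ≤
      (stdPi n).real ((fun g => X *ᵥ β + σ • g) ⁻¹' S) + (stdPi n).real B := by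
    refine (measureReal_mono fun g _ => ?_).trans (measureReal_union_le _ _)
    by_cases hg : g ∈ B
    · exact .inr hg
    · exact .inl (hS g hg)
  rw [probReal_univ] at h2
  linarith

lemma goodEvent_of_penaltyCondition {y : Fin n → ℝ} {β : Fin p → ℝ} {lam0 ξ ε : ℝ} (hξ : 1 < ξ)
    (hz : zStar X y β ≤ √(2 * Real.log (p / ε) / n)) (hC : PenaltyCondition X y β lam0 ξ ε) :
    GoodEvent X y β lam0 ξ := by
  obtain ⟨hτ, hC⟩ := hC
  refine hz.trans ?_
  rw [div_le_iff₀ (mul_pos (by linarith) (by linarith))] at hC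
  rw [le_div_iff₀ (by linarith), mul_div_right_comm]
  linarith

theorem uniform_probability_bound {δ : ℝ} (hδ : 0 < δ) : ∃ L : ℝ, 0 < L ∧
    ∀ (n p : ℕ) (X : Matrix (Fin n) (Fin p) ℝ) (β : Fin p → ℝ) (σ lam0 ξ ε : ℝ),
      0 < σ → 1 < ξ → 0 < ε → ColumnsNormalized X →
      L ≤ Real.log (p / ε) → Real.log (p / ε) < (n : ℝ) - 2 →
      (1 - (1 + δ) * ε / √(Real.pi * Real.log (p / ε)) ≤
        (pr X β σ).real {y | PenaltyCondition X y β lam0 ξ ε → GoodEvent X y β lam0 ξ}) ∧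
      ((∀ᵐ y ∂(pr X β σ), PenaltyCondition X y β lam0 ξ ε) →
        1 - (1 + δ) * ε / √(Real.pi * Real.log (p / ε)) ≤
          (pr X β σ).real {y | GoodEvent X y β lam0 ξ}) := by
  -- `2` is needed for the tail bound. Since `n > L + 2`, the other entry gives `n - 3 ≥ 3 / δ`,
  -- hence `n / (n - 3) ≤ 1 + δ`.
  refine ⟨max 2 (1 + 3 / δ), by positivity, ?_⟩
  intro n p X β σ lam0 ξ ε hσ hξ hε hX hL hLn
  set L := Real.log (p / ε) with hLdef
  have hL2 : 2 ≤ L := (le_max_left _ _).trans hL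
  have hLδ : 1 + 3 / δ ≤ L := (le_max_right _ _).trans hL
  have hn : 3 < n := by
    have : (3 : ℝ) < n := by linarith
    exact_mod_cast this
  have hn' : (3 : ℝ) < n := by exact_mod_cast hn
  have hp : (0 : ℝ) < p := by
    rcases Nat.eq_zero_or_pos p with rfl | hp
    -- For `p = 0` the convention `log 0 = 0` contradicts `L ≥ 2`.
    · simp [hLdef] at hL2
      linarith
    · exact_mod_cast hp
  have hexp : (p : ℝ) * Real.exp (-L) = ε := by
    rw [hLdef, Real.exp_neg, Real.exp_log (by positivity)]
    field_simp
  have hsqrt : √((n : ℝ) / (n - 3)) ≤ 1 + δ := by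
    rw [Real.sqrt_le_left (by positivity), div_le_iff₀ (by linarith)]
    have h3 : 3 ≤ δ * (n - 3) := by
      have : 3 / δ ≤ (n : ℝ) - 3 := by linarith
      rw [div_le_iff₀ hδ] at this
      linarith
    nlinarith
  have htail := stdPi_zStar_gt_le hn hX β hσ hL2
  have hbound : p * (√((n : ℝ) / (n - 3)) * Real.exp (-L) / √(Real.pi * L)) ≤
      (1 + δ) * ε / √(Real.pi * L) := by
    calc _ = √((n : ℝ) / (n - 3)) * (p * Real.exp (-L)) / √(Real.pi * L) := by ring
      _ ≤ _ := by rw [hexp]; gcongr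
  have hmain : 1 - (1 + δ) * ε / √(Real.pi * L) ≤
      (pr X β σ).real {y | PenaltyCondition X y β lam0 ξ ε → GoodEvent X y β lam0 ξ} := by
    refine one_sub_le_pr_real (htail.trans hbound) fun g hg hC => ?_
    exact goodEvent_of_penaltyCondition hξ (not_not.1 hg) hC
  refine ⟨hmain, fun hC => hmain.trans ?_⟩
  refine ENNReal.toReal_mono (measure_ne_top _ _) (measure_mono_ae ?_)
  filter_upwards [hC] with y hy hyg
  exact hyg hy

end ProbabilityBound

end ScaledLasso

namespace ScaledLasso

variable {n p : ℕ} {X : Matrix (Fin n) (Fin p) ℝ}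

/-! ### Distance of the noise level estimate from the oracle noise level. -/

section NoiseLevel

variable {y : Fin n → ℝ} {β : Fin p → ℝ} {lam0 ξ σ s : ℝ} {bhat : Fin p → ℝ} {shat : ℝ}

/-- On the good event the scaled lasso tracks the oracle noise level. -/
lemma IsScaledLasso.abs_sub_sigmaStar_le (h : IsScaledLasso X y lam0 bhat shat) (hlam0 : 0 < lam0)
    (hξ : 1 < ξ) (hσ : 0 < σ) (h1 : σ / 2 ≤ sigmaStar X y β) (h2 : sigmaStar X y β ≤ 2 * σ)
    (hs : lam0 * mu X β (σ * lam0) ξ / σ = s) {ρ : ℝ} (hsρ : 4 * s ≤ 1 - ρ) (hs1 : 4 * s ≤ 1 / 2)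
    (hz : zStar X y β ≤ ρ * lam0 * (ξ - 1) / (ξ + 1)) :
    |shat - sigmaStar X y β| ≤ 16 * s * σ := by
  have hσs : 0 < sigmaStar X y β := by linarith
  have hs0 : 0 ≤ s := hs ▸ div_nonneg (mul_nonneg hlam0.le (mu_nonneg _ _ _ _)) hσ.le
  -- One factor two comes from the linear growth of `μ`, the other from dividing by `sigmaStar ≥ σ /
  -- 2`.
  have hτ : tauStar X y β lam0 ξ ^ 2 ≤ 4 * s := by
    rw [tauStar_sq X y β ξ hlam0.le]
    have h3 : mu X β (sigmaStar X y β * lam0) ξ ≤ 2 * mu X β (σ * lam0) ξ :=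
      mu_le_mul_mu X β ξ one_le_two (by rw [← mul_assoc]; gcongr)
    calc lam0 * mu X β (sigmaStar X y β * lam0) ξ / sigmaStar X y β
        ≤ lam0 * (2 * mu X β (σ * lam0) ξ) / (σ / 2) := by
          have := mu_nonneg X β (σ * lam0) ξ
          gcongr
      _ = 4 * s := by rw [← hs]; field_simp; ring
  have hg : GoodEvent X y β lam0 ξ := by
    refine hz.trans ?_
    have : 0 ≤ (ξ - 1) / (ξ + 1) := div_nonneg (by linarith) (by linarith)
    rw [mul_div_assoc, mul_div_assoc]
    gcongr
    linarith
  obtain ⟨hmax, hpos⟩ := h.oracle_inequality hlam0 hξ hσs hg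
  obtain ⟨hshat, -⟩ := hpos (by linarith)
  have hτ0 : 0 ≤ tauStar X y β lam0 ξ ^ 2 := sq_nonneg _
  have h3 := (le_max_left _ _).trans hmax
  have h4 := (le_max_right _ _).trans hmax
  rw [sub_le_comm, le_div_iff₀ hσs] at h3
  rw [sub_le_comm, le_div_iff₀ hshat] at h4
  have h5 : shat ≤ 2 * sigmaStar X y β := by nlinarith
  have h6 : tauStar X y β lam0 ξ ^ 2 * shat ≤ 4 * s * (2 * sigmaStar X y β) := by gcongr
  have h7 : tauStar X y β lam0 ξ ^ 2 * sigmaStar X y β ≤ 4 * s * sigmaStar X y β := by gcongr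
  have h8 : s * sigmaStar X y β ≤ s * (2 * σ) := by gcongr
  have h9 : 0 ≤ s * σ := by positivity
  rw [abs_le]
  constructor <;> linarith

/-- A bound for the `ℓ₁` excess which does not require the penalty to dominate the noise, but
involves the energy `K` of the noise along the columns of the design. -/
lemma IsScaledLasso.mul_l1_sub_le (h : IsScaledLasso X y lam0 bhat shat) (hn : 0 < n)
    (hlam0 : 0 < lam0) (hξ : 1 < ξ) (hσ : 0 < σ) {T : Finset (Fin p)} {ν a r K : ℝ} (hK : 0 ≤ K)
    (hd : DominatedBy X β (σ * lam0) ξ T ν a) (hr : lam0 * a / σ ≤ r)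
    (hW : ∀ u, ((y - X *ᵥ β) ⬝ᵥ (X *ᵥ u)) ^ 2 ≤ l2 (X *ᵥ u) ^ 2 * (σ ^ 2 * K)) :
    lam0 * (l1 β - l1 bhat) ≤ 4 * r * σ + 2 * σ * √(8 * r * K / n) + 16 * r * shat := by
  obtain ⟨hν0, hν1, ha, hbias, hvar⟩ := hd
  have hn' : (0 : ℝ) < n := by exact_mod_cast hn
  have hr0 : 0 ≤ r := le_trans (by positivity) hr
  have hs0 : 0 ≤ shat := h.1.1
  rw [div_le_iff₀ hσ] at hr
  have hdec := l1_sub_l1_le T β bhat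
  have hbasic := sq_l2_mulVec_sub_le (h.variational hn hlam0.le β)
  have hWh := hW (bhat - β)
  have hB : l1On Tᶜ β ≤ a := hbias.trans (mul_le_of_le_one_right ha hν1.le)
  have hvar' := hvar (bhat - β)
  set D := l1 β - l1 bhat
  set H := bhat - β with hH
  set q := l2 (X *ᵥ H) ^ 2 / n with hq
  set c := (y - X *ᵥ β) ⬝ᵥ (X *ᵥ H) / n with hc
  have hq0 : 0 ≤ q := by positivity
  set x := l1On T H with hx
  set z := l1On Tᶜ H with hz
  have hx0 : 0 ≤ x := l1On_nonneg _ _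
  have hz0 : 0 ≤ z := l1On_nonneg _ _
  have hA : 0 ≤ 2 * σ * √(8 * r * K / n) := by positivity
  have hA2 : 0 ≤ 16 * r * shat := by positivity
  -- An excess above `4 a` outweighs the bias: then `z < x`, so `H` lies even in the cone with
  -- constant one, and the compatibility bound applies.
  rcases le_or_gt D (4 * a) with hcase | hcase
  · have : lam0 * D ≤ lam0 * (4 * a) := by gcongr
    have : 0 ≤ 4 * r * σ := by positivity
    linarith
  have hxa : 2 * a + z < x := by linarith
  have hxpos : 0 < x := by linarith
  have hDx : D ≤ 2 * x := by linarith
  have hν1' : 0 < 1 - ν := by linarith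
  have hcone : H ∈ cone ((ξ + ν) / (1 - ν)) T := by
    change z ≤ (ξ + ν) / (1 - ν) * x
    have : 1 ≤ (ξ + ν) / (1 - ν) := by rw [one_le_div hν1']; linarith
    nlinarith
  have hne : H ≠ 0 := by
    intro h0
    rw [hx, h0] at hxpos
    simp [l1On] at hxpos
  have hTpos : (0 : ℝ) < T.card := by
    rw [Nat.cast_pos, Finset.card_pos, Finset.nonempty_iff_ne_empty]
    rintro rfl
    exact hxpos.ne' Finset.sum_empty
  have hv : σ * lam0 * x ^ 2 ≤ 2 * a * q := by
    have h1 := hvar' hcone hne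
    have h2 : l2 (X *ᵥ H) ^ 2 = q * n := by rw [hq]; field_simp
    rw [h2, div_mul_eq_mul_div, div_le_iff₀ (by positivity)] at h1
    have h3 : (T.card * n : ℝ) * (σ * lam0 * x ^ 2) ≤ (T.card * n) * (2 * (1 - ν) * a * q) := by
      linarith
    have h4 := le_of_mul_le_mul_left h3 (mul_pos hTpos hn')
    have h5 : 0 ≤ a * q * ν := by positivity
    linarith
  have hqc : q ≤ c + 2 * (shat * lam0 * x) := by
    have : shat * lam0 * D ≤ shat * lam0 * (2 * x) := by gcongr
    linarith
  -- Either the noise term dominates and the energy bounds `q` by `4 σ² K / n`, or the penalty term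
  -- dominates and a factor `x` cancels.
  rcases le_or_gt (q / 2) c with hcq | hcq
  · have h1 : c ^ 2 ≤ q * (σ ^ 2 * K / n) := by
      rw [hc, hq, div_pow, div_mul_div_comm, ← sq]
      gcongr
    have h2 : q * q ≤ q * (4 * (σ ^ 2 * K / n)) := by
      have : (q / 2) ^ 2 ≤ c ^ 2 := by gcongr
      linarith
    have h3 : q ≤ 4 * (σ ^ 2 * K / n) := by
      rcases hq0.eq_or_lt with h0 | h0
      · rw [← h0]; positivity
      · exact le_of_mul_le_mul_left h2 h0
    have h4 : (lam0 * x) ^ 2 ≤ σ ^ 2 * (8 * r * K / n) := by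
      have e1 : σ * (lam0 * x) ^ 2 ≤ σ * (σ ^ 2 * (8 * r * K / n)) := by
        calc σ * (lam0 * x) ^ 2 = lam0 * (σ * lam0 * x ^ 2) := by ring
          _ ≤ lam0 * (2 * a * (4 * (σ ^ 2 * K / n))) := by
              refine mul_le_mul_of_nonneg_left ?_ hlam0.le
              exact hv.trans (mul_le_mul_of_nonneg_left h3 (by positivity))
          _ = lam0 * a * (8 * (σ ^ 2 * K / n)) := by ring
          _ ≤ r * σ * (8 * (σ ^ 2 * K / n)) := by gcongr
          _ = _ := by ring
      exact le_of_mul_le_mul_left e1 hσ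
    have h5 : lam0 * x ≤ σ * √(8 * r * K / n) := by
      refine le_of_sq_le_sq ?_ (by positivity)
      rwa [mul_pow σ, Real.sq_sqrt (by positivity)]
    have h6 : lam0 * D ≤ lam0 * (2 * x) := by gcongr
    have : 0 ≤ 4 * r * σ := by positivity
    linarith
  · have h1 : q ≤ 4 * (shat * lam0 * x) := by linarith
    have h2 : (lam0 * x) * (σ * x) ≤ (lam0 * x) * (8 * a * shat) := by
      have : 2 * a * q ≤ 2 * a * (4 * (shat * lam0 * x)) := by gcongr
      linarith
    have h3 := le_of_mul_le_mul_left h2 (by positivity)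
    have h4 : σ * (lam0 * x) ≤ σ * (8 * r * shat) := by
      calc σ * (lam0 * x) = lam0 * (σ * x) := by ring
        _ ≤ lam0 * (8 * a * shat) := by gcongr
        _ = lam0 * a * (8 * shat) := by ring
        _ ≤ r * σ * (8 * shat) := by gcongr
        _ = _ := by ring
    have h5 := le_of_mul_le_mul_left h4 hσ
    have h6 : lam0 * D ≤ lam0 * (2 * x) := by gcongr
    have : 0 ≤ 4 * r * σ := by positivity
    linarith

/-- A bound for the error of the noise level estimator in terms of the energy `K` of the noise
along the columns of the design. -/
lemma IsScaledLasso.abs_sub_sigmaStar_le_of_energy (h : IsScaledLasso X y lam0 bhat shat)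
    (hn : 0 < n) (hlam0 : 0 ≤ lam0) (hξ : 1 < ξ) (hσ : 0 < σ) (h1 : σ / 2 ≤ sigmaStar X y β)
    (h2 : sigmaStar X y β ≤ 2 * σ) {r K : ℝ} (hK : 0 ≤ K) (hr0 : 0 ≤ r)
    (hsr : lam0 * mu X β (σ * lam0) ξ / σ < r) (hr : 32 * r ≤ 1)
    (hW : ∀ u, ((y - X *ᵥ β) ⬝ᵥ (X *ᵥ u)) ^ 2 ≤ l2 (X *ᵥ u) ^ 2 * (σ ^ 2 * K)) :
    |shat - sigmaStar X y β| ≤ σ * (2 * K / n + 72 * r + 4 * √(8 * r * K / n)) := by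
  have hn' : (0 : ℝ) < n := by exact_mod_cast hn
  have hs0 : 0 ≤ shat := h.1.1
  have hA : 0 ≤ √(8 * r * K / n) := Real.sqrt_nonneg _
  have hKn : 0 ≤ K / n := by positivity
  have hσs : 0 < sigmaStar X y β := by linarith
  rw [abs_le]
  constructor
  -- Whatever the fit, it removes at most the energy `σ² K` from the squared residual, by completing
  -- the square.
  · have h3 : sigmaStar X y β ^ 2 - σ ^ 2 * K / n ≤ shat ^ 2 := by
      rw [h.shat_eq hn, sigmaStar_sq, sigmaStar_sq, ← sub_div]
      gcongr
      have e1 : y - X *ᵥ bhat = (y - X *ᵥ β) - X *ᵥ (bhat - β) := by rw [mulVec_sub]; abel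
      rw [e1, sq_l2_sub (y - X *ᵥ β)]
      have h4 := hW (bhat - β)
      generalize (y - X *ᵥ β) ⬝ᵥ (X *ᵥ (bhat - β)) = c at h4 ⊢
      have h5 := l2_nonneg (X *ᵥ (bhat - β))
      generalize l2 (X *ᵥ (bhat - β)) = w at h4 h5 ⊢
      have h6 : |c| ≤ w * (σ * √K) := by
        refine abs_le_of_sq_le_sq ?_ (by positivity)
        rw [mul_pow, mul_pow, Real.sq_sqrt hK]
        exact h4
      have h7 := le_abs_self c
      have h8 : σ ^ 2 * K = (σ * √K) ^ 2 := by rw [mul_pow, Real.sq_sqrt hK]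
      rw [h8]
      nlinarith [sq_nonneg (w - σ * √K)]
    rcases le_or_gt (sigmaStar X y β) shat with hle | hgt
    · have : 0 ≤ σ * (2 * K / n + 72 * r + 4 * √(8 * r * K / n)) := by positivity
      linarith
    · have h4 : (sigmaStar X y β - shat) * (σ / 2) ≤ σ ^ 2 * K / n := by
        calc (sigmaStar X y β - shat) * (σ / 2)
            ≤ (sigmaStar X y β - shat) * (sigmaStar X y β + shat) := by
              refine mul_le_mul_of_nonneg_left ?_ ?_ <;> linarith
          _ ≤ _ := by linarith
      have h5 : (sigmaStar X y β - shat) * (σ / 2) ≤ (σ * (2 * K / n)) * (σ / 2) := by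
        refine h4.trans (le_of_eq ?_)
        ring
      have h6 := le_of_mul_le_mul_right h5 (by linarith)
      have : 0 ≤ σ * (72 * r + 4 * √(8 * r * K / n)) := by positivity
      linarith
  · have h3 := h.le_sqrtLoss hn β
    have h4 : 0 ≤ σ * (2 * K / n) := by positivity
    rcases hlam0.eq_or_lt with h0 | h0
    · have : 0 ≤ σ * (2 * K / n + 72 * r + 4 * √(8 * r * K / n)) := by positivity
      rw [← h0] at h3
      linarith
    -- This `δ` turns the strict gap below `r` into `lam0 * a / σ ≤ r`.
    · obtain ⟨T, ν, a, hd, hlt⟩ := exists_dominatedBy_lt (X := X) (β := β) (lam := σ * lam0)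
        (ξ := ξ) (δ := (r - lam0 * mu X β (σ * lam0) ξ / σ) * σ / lam0) hn (by linarith)
        (div_pos (mul_pos (by linarith) hσ) h0)
      have ha := hd.nonneg
      have h5 : lam0 * a / σ ≤ r := by
        rw [div_le_iff₀ hσ]
        calc lam0 * a ≤ lam0 * ((ξ + 1) * a) := by
              gcongr
              exact le_mul_of_one_le_left ha (by linarith)
          _ ≤ lam0 * (mu X β (σ * lam0) ξ +
                (r - lam0 * mu X β (σ * lam0) ξ / σ) * σ / lam0) := by gcongr
          _ = r * σ := by field_simp; ring
      have h6 := h.mul_l1_sub_le hn h0 hξ hσ hK hd h5 hW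
      have h8 : 0 ≤ σ * (72 * r + 4 * √(8 * r * K / n)) := by positivity
      rcases le_or_gt 0 (lam0 * (l1 β - l1 bhat)) with hD | hD
      -- Replacing `shat` by `2 σ` plus the excess lets half of the excess be absorbed, as `16 r ≤ 1
      -- / 2`. Hence `72 = 2 (4 + 32)` and `4 = 2 · 2`.
      · have h9 : 16 * r * shat ≤ 16 * r * (2 * σ + lam0 * (l1 β - l1 bhat)) := by
          gcongr
          linarith
        have h10 : 16 * r * (lam0 * (l1 β - l1 bhat)) ≤ 1 / 2 * (lam0 * (l1 β - l1 bhat)) :=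
          mul_le_mul_of_nonneg_right (by linarith) hD
        linarith
      · linarith

end NoiseLevel

/-- The energy of a vector along the column space of `X`. -/
lemma exists_energy (X : Matrix (Fin n) (Fin p) ℝ) :
    ∃ d ≤ p, ∃ v : Fin d → Fin n → ℝ, (∀ k, l2 (v k) = 1) ∧
      ∀ (u : Fin p → ℝ) (g : Fin n → ℝ),
        (g ⬝ᵥ (X *ᵥ u)) ^ 2 ≤ l2 (X *ᵥ u) ^ 2 * ∑ k, (v k ⬝ᵥ g) ^ 2 := by
  have hnorm : ∀ w : EuclideanSpace ℝ (Fin n), ‖w‖ = l2 w := by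
    intro w
    rw [EuclideanSpace.norm_eq, l2]
    simp
  set col : Fin p → EuclideanSpace ℝ (Fin n) := fun j => WithLp.toLp 2 fun i => X i j with hcol
  set S : Submodule ℝ (EuclideanSpace ℝ (Fin n)) := Submodule.span ℝ (Set.range col) with hS
  set b := stdOrthonormalBasis ℝ S with hb
  refine ⟨Module.finrank ℝ S, ?_, fun k => (b k : EuclideanSpace ℝ (Fin n)), fun k => ?_, ?_⟩
  · exact (finrank_range_le_card (R := ℝ) col).trans_eq (Fintype.card_fin p)
  · rw [← hnorm]
    exact b.orthonormal.1 k
  · intro u g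
    have hmem : WithLp.toLp 2 (X *ᵥ u) ∈ S := by
      have : WithLp.toLp 2 (X *ᵥ u) = ∑ j, u j • col j := by
        ext i
        simp [hcol, mulVec, dotProduct, mul_comm]
      rw [this]
      exact Submodule.sum_mem _ fun j _ => Submodule.smul_mem _ _ (Submodule.subset_span ⟨j, rfl⟩)
    set w : S := ⟨WithLp.toLp 2 (X *ᵥ u), hmem⟩ with hw
    have e1 : g ⬝ᵥ (X *ᵥ u) = ∑ k, b.repr w k * ((b k : EuclideanSpace ℝ (Fin n)) ⬝ᵥ g) := by
      have h1 : ((∑ k, b.repr w k • b k : S) : EuclideanSpace ℝ (Fin n)) =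
          WithLp.toLp 2 (X *ᵥ u) := by rw [b.sum_repr]
      have h2 : (X *ᵥ u) = ∑ k, b.repr w k • ((b k : EuclideanSpace ℝ (Fin n)) : Fin n → ℝ) := by
        refine (congrArg WithLp.ofLp h1).symm.trans ?_
        simp
      conv_lhs => rw [h2]
      rw [dotProduct_sum]
      simp_rw [dotProduct_smul, smul_eq_mul]
      exact Finset.sum_congr rfl fun k _ => by rw [dotProduct_comm]
    have e2 : l2 (X *ᵥ u) ^ 2 = ∑ k, b.repr w k ^ 2 := by
      have h1 : l2 (X *ᵥ u) = ‖w‖ := (hnorm (WithLp.toLp 2 (X *ᵥ u))).symm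
      rw [h1, ← b.repr.norm_map, EuclideanSpace.real_norm_sq_eq]
    rw [e1, e2]
    exact Finset.sum_mul_sq_le_sq_mul_sq _ _ _

end ScaledLasso

namespace ScaledLasso

/-! ### Gaussian moments and Chebyshev bounds. -/

section Moments

lemma integrable_pow_gaussianReal (k : ℕ) : Integrable (fun x : ℝ => x ^ k) (gaussianReal 0 1) := by
  have := (memLp_id_gaussianReal (μ := 0) (v := 1) k).integrable_norm_pow'
  refine this.mono (by fun_prop) (ae_of_all _ fun x => ?_)
  simp

lemma integral_sq_gaussianReal : ∫ x, x ^ 2 ∂(gaussianReal 0 1) = 1 := by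
  have h := variance_fun_id_gaussianReal (μ := 0) (v := 1)
  rw [variance_eq_integral (by fun_prop), integral_id_gaussianReal] at h
  simpa using h

lemma integral_pow_four_gaussianReal : ∫ x, x ^ 4 ∂(gaussianReal 0 1) = 3 := by
  rw [integral_gaussianReal_eq_integral_smul one_ne_zero]
  have h1 : ∀ x : ℝ, gaussianPDFReal 0 1 x • x ^ 4 =
      (fun t : ℝ => (√(2 * Real.pi))⁻¹ * (t ^ (4 : ℝ) * Real.exp (-(1 / 2) * t ^ (2 : ℝ)))) |x| := by
    intro x
    have : gaussianPDFReal 0 1 x = (√(2 * Real.pi))⁻¹ * Real.exp (-(x ^ 2 / 2)) := by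
      simp [gaussianPDFReal, neg_div]
    have h4 : |x| ^ (4 : ℝ) = x ^ 4 := by
      rw [show (4 : ℝ) = ((4 : ℕ) : ℝ) by norm_num, Real.rpow_natCast, Even.pow_abs (by decide)]
    have h2 : |x| ^ (2 : ℝ) = x ^ 2 := by
      rw [show (2 : ℝ) = ((2 : ℕ) : ℝ) by norm_num, Real.rpow_natCast, sq_abs]
    simp only [h4, h2]
    rw [this, smul_eq_mul]
    ring_nf
  rw [integral_congr_ae (ae_of_all _ h1), integral_comp_abs (f := fun t : ℝ =>
    (√(2 * Real.pi))⁻¹ * (t ^ (4 : ℝ) * Real.exp (-(1 / 2) * t ^ (2 : ℝ)))), integral_const_mul,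
    integral_rpow_mul_exp_neg_mul_rpow (by norm_num) (by norm_num) (by norm_num)]
  have hG : Real.Gamma ((4 + 1) / 2) = 3 / 4 * √Real.pi := by
    rw [show ((4 : ℝ) + 1) / 2 = (1 / 2 + 1) + 1 by norm_num, Real.Gamma_add_one (by norm_num),
      Real.Gamma_add_one (by norm_num), Real.Gamma_one_half_eq]
    ring
  have hP : ((1 : ℝ) / 2) ^ (-((4 : ℝ) + 1) / 2) = 4 * √2 := by
    rw [one_div, Real.inv_rpow two_pos.le, ← Real.rpow_neg two_pos.le,
      show -(-((4 : ℝ) + 1) / 2) = 2 + 1 / 2 by norm_num, Real.rpow_add two_pos,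
      ← Real.sqrt_eq_rpow]
    norm_num
  rw [hG, hP, Real.sqrt_mul two_pos.le]
  have hp : 0 < √Real.pi := Real.sqrt_pos.2 Real.pi_pos
  field_simp

lemma memLp_sq_gaussianReal : MemLp (fun x : ℝ => x ^ 2) 2 (gaussianReal 0 1) := by
  rw [memLp_two_iff_integrable_sq (by fun_prop)]
  simpa [← pow_mul] using integrable_pow_gaussianReal 4

lemma variance_sq_gaussianReal : Var[fun x => x ^ 2; gaussianReal 0 1] = 2 := by
  rw [variance_eq_sub memLp_sq_gaussianReal, integral_sq_gaussianReal]
  have : ∫ x : ℝ, ((fun x : ℝ => x ^ 2) ^ 2) x ∂(gaussianReal 0 1) = 3 := by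
    rw [← integral_pow_four_gaussianReal]
    simp [← pow_mul]
  rw [this]
  norm_num

variable {n : ℕ}

/-- Chebyshev's inequality for a sum of functions of the coordinates. -/
lemma stdPi_real_sum_ge_le {f : Fin n → ℝ → ℝ} (hf : ∀ i, MemLp (f i) 2 (gaussianReal 0 1))
    {c : ℝ} (hc : 0 < c) :
    (stdPi n).real {g | c ≤ |∑ i, f i (g i) - ∑ i, ∫ x, f i x ∂(gaussianReal 0 1)|} ≤
      (∑ i, Var[f i; gaussianReal 0 1]) / c ^ 2 := by
  have hL : ∀ i, MemLp (fun g : Fin n → ℝ => f i (g i)) 2 (stdPi n) := fun i =>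
    (hf i).comp_measurePreserving (measurePreserving_eval (fun _ : Fin n => gaussianReal 0 1) i)
  have hmem : MemLp (∑ i, fun g : Fin n → ℝ => f i (g i)) 2 (stdPi n) :=
    memLp_finsetSum' _ fun i _ => hL i
  have hvar := variance_sum_pi (μ := fun _ : Fin n => gaussianReal 0 1) hf
  have hmean : ∫ g, (∑ i, fun g : Fin n → ℝ => f i (g i)) g ∂(stdPi n) =
      ∑ i, ∫ x, f i x ∂(gaussianReal 0 1) := by
    simp only [Finset.sum_apply]
    rw [integral_finsetSum _ fun i _ => (hL i).integrable (by norm_num)]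
    refine Finset.sum_congr rfl fun i _ => ?_
    have hmp := measurePreserving_eval (fun _ : Fin n => gaussianReal 0 1) i
    have h1 := integral_map (μ := stdPi n) (φ := Function.eval i) (f := f i)
      hmp.measurable.aemeasurable (by rw [hmp.map_eq]; exact (hf i).1)
    rw [hmp.map_eq] at h1
    exact h1.symm
  have hch := meas_ge_le_variance_div_sq hmem hc
  rw [hvar, hmean] at hch
  simp only [Finset.sum_apply] at hch
  exact ENNReal.toReal_le_of_le_ofReal
    (div_nonneg (Finset.sum_nonneg fun i _ => variance_nonneg _ _) (sq_nonneg c)) hch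

/-- Concentration of the chi-square distribution. -/
lemma stdPi_real_sum_sq_sub_ge_le (n : ℕ) {c : ℝ} (hc : 0 < c) :
    (stdPi n).real {g | c ≤ |∑ i, g i ^ 2 - n|} ≤ 2 * n / c ^ 2 := by
  have h := stdPi_real_sum_ge_le (n := n) (f := fun _ x => x ^ 2)
    (fun _ => memLp_sq_gaussianReal) hc
  simp only [integral_sq_gaussianReal, variance_sq_gaussianReal, Finset.sum_const,
    Finset.card_univ, Fintype.card_fin, nsmul_eq_mul, mul_one] at h
  rwa [mul_comm 2 (n : ℝ)]

lemma stdPi_real_dotProduct_ge_le {v : Fin n → ℝ} (hv : l2 v = 1) {c : ℝ} (hc : 0 < c) :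
    (stdPi n).real {g | c ≤ |v ⬝ᵥ g|} ≤ 1 / c ^ 2 := by
  have h := stdPi_real_sum_ge_le (n := n) (f := fun i x => v i * x)
    (fun i => (memLp_id_gaussianReal 2).const_mul (v i)) hc
  have hvar : ∑ i, Var[fun x => v i * x; gaussianReal 0 1] = 1 := by
    have : ∀ i, Var[fun x => v i * x; gaussianReal 0 1] = v i ^ 2 := by
      intro i
      rw [variance_const_mul, variance_fun_id_gaussianReal]
      simp
    simp_rw [this]
    rw [← l2_sq_eq_sum, hv, one_pow]
  rw [hvar] at h
  have hmean : ∀ i, ∫ x, v i * x ∂(gaussianReal 0 1) = 0 := fun i => by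
    rw [integral_const_mul, integral_id_gaussianReal, mul_zero]
  simp only [hmean, Finset.sum_const_zero, sub_zero] at h
  exact h

/-- The energy of the noise along a subspace of bounded dimension is bounded in probability. -/
lemma stdPi_real_energy_gt_le {d M : ℕ} (hd : d ≤ M) {v : Fin d → Fin n → ℝ}
    (hv : ∀ k, l2 (v k) = 1) {c : ℝ} (hc : 0 < c) :
    (stdPi n).real {g | M * c ^ 2 < ∑ k, (v k ⬝ᵥ g) ^ 2} ≤ M / c ^ 2 := by
  have hsub : {g : Fin n → ℝ | M * c ^ 2 < ∑ k, (v k ⬝ᵥ g) ^ 2} ⊆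
      ⋃ k, {g | c ≤ |v k ⬝ᵥ g|} := by
    intro g hg
    by_contra hcon
    simp only [Set.mem_iUnion, Set.mem_ofPred_eq, not_exists, not_le] at hcon
    refine absurd (show M * c ^ 2 < ∑ k, (v k ⬝ᵥ g) ^ 2 from hg) (not_lt.2 ?_)
    calc ∑ k, (v k ⬝ᵥ g) ^ 2 ≤ ∑ _k : Fin d, c ^ 2 :=
          Finset.sum_le_sum fun k _ => sq_le_sq' (abs_lt.1 (hcon k)).1.le (abs_lt.1 (hcon k)).2.le
      _ = d * c ^ 2 := by simp
      _ ≤ M * c ^ 2 := by gcongr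
  refine (measureReal_mono hsub).trans ((measureReal_iUnion_fintype_le _).trans ?_)
  calc ∑ k, (stdPi n).real {g | c ≤ |v k ⬝ᵥ g|} ≤ ∑ _k : Fin d, 1 / c ^ 2 :=
        Finset.sum_le_sum fun k _ => stdPi_real_dotProduct_ge_le (hv k) hc
    _ = d / c ^ 2 := by simp [div_eq_mul_inv]
    _ ≤ M / c ^ 2 := by gcongr

end Moments

/-! ### Asymptotic equivalence of the estimate and the oracle noise level. -/

section Consistency

/-- The oracle noise level is within a factor two of `σ` unless the squared noise deviates. -/
lemma sigmaStar_mem_of_abs_lt {n p : ℕ} (hn : 0 < n) (X : Matrix (Fin n) (Fin p) ℝ)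
    (β : Fin p → ℝ) {σ : ℝ} (hσ : 0 < σ) {g : Fin n → ℝ}
    (hg : |∑ i, g i ^ 2 - (n : ℝ)| < 3 / 4 * n) :
    σ / 2 ≤ sigmaStar X (X *ᵥ β + σ • g) β ∧ sigmaStar X (X *ᵥ β + σ • g) β ≤ 2 * σ := by
  have hn' : (0 : ℝ) < n := by exact_mod_cast hn
  rw [sigmaStar_add_smul β hσ, l2, ← Real.sqrt_div (Finset.sum_nonneg fun i _ => sq_nonneg _)]
  obtain ⟨h1, h2⟩ := abs_lt.1 hg
  have h3 : 1 / 2 ≤ √((∑ i, g i ^ 2) / n) := by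
    refine Real.le_sqrt_of_sq_le ?_
    rw [le_div_iff₀ hn']
    linarith
  have h4 : √((∑ i, g i ^ 2) / n) ≤ 2 := by
    refine Real.sqrt_le_iff.2 ⟨two_pos.le, ?_⟩
    rw [div_le_iff₀ hn']
    linarith
  constructor <;> nlinarith

/-- Expresses the tail threshold at `L = B² log p` as a fixed fraction of the penalty side of the
good event, leaving room for `τ_*²`. -/
lemma sqrt_two_mul_div_eq {A ξ n : ℝ} (hA : (ξ + 1) / (ξ - 1) < A) (hξ : 1 < ξ) (ℓ : ℝ)
    {B : ℝ} (hB : 0 ≤ B) :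
    √(2 * (B ^ 2 * ℓ) / n) =
      B / (A * (ξ - 1) / (ξ + 1)) * (A * √(2 / n * ℓ)) * (ξ - 1) / (ξ + 1) := by
  have hA0 : 0 < A := lt_trans (div_pos (by linarith) (by linarith)) hA
  have h1 : 0 < ξ - 1 := by linarith
  have h2 : 0 < ξ + 1 := by linarith
  have : 2 * (B ^ 2 * ℓ) / n = B ^ 2 * (2 / n * ℓ) := by ring
  rw [this, Real.sqrt_mul (sq_nonneg B), Real.sqrt_sq hB]
  field_simp

/-- For a dimension above a threshold the tail bound is small. -/
lemma exists_dimension_threshold {B ε : ℝ} (hB : 1 < B) (hε : 0 < ε) :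
    ∃ M : ℕ, 2 ≤ M ∧ ∀ p : ℕ, M ≤ p →
      2 ≤ B ^ 2 * Real.log p ∧ 2 * (p * Real.exp (-(B ^ 2 * Real.log p))) ≤ ε := by
  have hlog : Tendsto (fun p : ℕ => Real.log p) atTop atTop :=
    Real.tendsto_log_atTop.comp tendsto_natCast_atTop_atTop
  have h1 : Tendsto (fun p : ℕ => B ^ 2 * Real.log p) atTop atTop :=
    hlog.const_mul_atTop (by positivity)
  have h2 : Tendsto (fun p : ℕ => 2 * Real.exp (-((B ^ 2 - 1) * Real.log p))) atTop (𝓝 (2 * 0)) :=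
    (Real.tendsto_exp_atBot.comp (tendsto_neg_atTop_atBot.comp
      (hlog.const_mul_atTop (by nlinarith)))).const_mul 2
  rw [mul_zero] at h2
  obtain ⟨M, hM⟩ := eventually_atTop.1 ((h1.eventually_ge_atTop 2).and
    (h2.eventually_le_const hε))
  refine ⟨max M 2, le_max_right _ _, fun p hp => ?_⟩
  obtain ⟨h3, h4⟩ := hM p ((le_max_left _ _).trans hp)
  refine ⟨h3, (le_of_eq ?_).trans h4⟩
  have hp0 : (0 : ℝ) < p := by
    have : 0 < p := lt_of_lt_of_le two_pos ((le_max_right _ _).trans hp)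
    exact_mod_cast this
  nth_rewrite 1 [← Real.exp_log hp0]
  rw [← Real.exp_add]
  ring_nf

variable {A ξ : ℝ} {p : ℕ → ℕ} {X : ∀ n, Matrix (Fin n) (Fin (p n)) ℝ}
  {β : ∀ n, Fin (p n) → ℝ} {σ : ℕ → ℝ}
  {bhat : ∀ n, (Fin n → ℝ) → (Fin (p n) → ℝ)} {shat : ∀ n, (Fin n → ℝ) → ℝ}

/-- The noise level estimator is asymptotically equivalent to the oracle noise level. -/
theorem tendsto_stdPi_abs_shat_sub_sigmaStar_ge (hξ : 1 < ξ) (hA : (ξ + 1) / (ξ - 1) < A)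
    (hσ : ∀ n, 0 < σ n) (hX : ∀ n, ColumnsNormalized (X n))
    (hlasso : ∀ n, ∀ᵐ y ∂(pr (X n) (β n) (σ n)),
      IsScaledLasso (X n) y (penaltyLevel A n (p n)) (bhat n y) (shat n y))
    (hrate : (fun n => penaltyLevel A n (p n) *
        mu (X n) (β n) (σ n * penaltyLevel A n (p n)) ξ / σ n)
      =o[atTop] fun n : ℕ => (n : ℝ) ^ (-(1 / 2) : ℝ)) {η : ℝ} (hη : 0 < η) :
    Tendsto (fun n => (stdPi n).real {g | η * σ n ≤ √(n : ℝ) *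
      |shat n (X n *ᵥ β n + σ n • g) - sigmaStar (X n) (X n *ᵥ β n + σ n • g) (β n)|})
      atTop (𝓝 0) := by
  have hA0 : 0 < A := lt_trans (div_pos (by linarith) (by linarith)) hA
  set s : ℕ → ℝ := fun n => penaltyLevel A n (p n) *
    mu (X n) (β n) (σ n * penaltyLevel A n (p n)) ξ / σ n with hs
  have hlam : ∀ n, 0 ≤ penaltyLevel A n (p n) := fun n =>
    mul_nonneg hA0.le (Real.sqrt_nonneg _)
  have hs0 : ∀ n, 0 ≤ s n := fun n =>
    div_nonneg (mul_nonneg (hlam n) (mu_nonneg _ _ _ _)) (hσ n).le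
  have hns : Tendsto (fun n : ℕ => √(n : ℝ) * s n) atTop (𝓝 0) := by
    refine hrate.tendsto_div_nhds_zero.congr fun n => ?_
    rw [Real.rpow_neg (Nat.cast_nonneg n), ← Real.sqrt_eq_rpow, div_inv_eq_mul, mul_comm]
  have hsqrt : Tendsto (fun n : ℕ => √(n : ℝ)) atTop atTop :=
    Real.tendsto_sqrt_atTop.comp tendsto_natCast_atTop_atTop
  have hinv : Tendsto (fun n : ℕ => (√(n : ℝ))⁻¹) atTop (𝓝 0) := tendsto_inv_atTop_zero.comp hsqrt
  have hle_sqrt : ∀ᶠ n : ℕ in atTop, (1 : ℝ) ≤ √(n : ℝ) := hsqrt.eventually_ge_atTop 1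
  have hs_tendsto : Tendsto s atTop (𝓝 0) := by
    refine squeeze_zero' (Eventually.of_forall hs0) ?_ hns
    filter_upwards [hle_sqrt] with n hn
    exact le_mul_of_one_le_left (hs0 n) hn
  set A' : ℝ := A * (ξ - 1) / (ξ + 1) with hA'
  have hA'1 : 1 < A' := by
    rw [hA', one_lt_div (by linarith)]
    rwa [div_lt_iff₀ (by linarith)] at hA
  -- Halfway between `1` and `A'`: `B > 1` makes `p · p^{-B²}` vanish for large `p`, and `B < A'`
  -- leaves the margin `1 - B / A'` for `4 s`.
  set B : ℝ := (1 + A') / 2 with hB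
  have hB1 : 1 < B := by linarith
  have hρ : B / A' < 1 := by rw [div_lt_one (by linarith)]; linarith
  have hdev : Tendsto (fun n : ℕ => (stdPi n).real {g | 3 / 4 * (n : ℝ) ≤ |∑ i, g i ^ 2 - n|})
      atTop (𝓝 0) := by
    have h1 : Tendsto (fun n : ℕ => 32 / 9 * ((n : ℝ))⁻¹) atTop (𝓝 (32 / 9 * 0)) :=
      (tendsto_inv_atTop_zero.comp tendsto_natCast_atTop_atTop).const_mul _
    rw [mul_zero] at h1
    refine squeeze_zero' (Eventually.of_forall fun n => measureReal_nonneg) ?_ h1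
    filter_upwards [eventually_gt_atTop 0] with n hn
    have hn' : (0 : ℝ) < n := by exact_mod_cast hn
    refine (stdPi_real_sum_sq_sub_ge_le n (by positivity)).trans (le_of_eq ?_)
    field_simp
    norm_num
  refine Metric.tendsto_nhds.2 fun ε hε => ?_
  obtain ⟨M, hM2, hM⟩ := exists_dimension_threshold hB1 (by positivity : 0 < ε / 4)
  -- Makes the Chebyshev bound `M / c²` for the energy equal to `ε / 4`.
  set c : ℝ := √(4 * M / ε) with hc
  have hM0 : (0 : ℝ) < M := by
    have : 0 < M := by omega
    exact_mod_cast this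
  have hc0 : 0 < c := Real.sqrt_pos.2 (by positivity)
  have hc2 : c ^ 2 = 4 * M / ε := Real.sq_sqrt (by positivity)
  set K : ℝ := M * c ^ 2 with hK
  have hK0 : 0 ≤ K := by positivity
  -- The summand `1 / n` makes `s n < r n` strict and is still `o(n^{-1/2})`.
  set r : ℕ → ℝ := fun n => s n + (n : ℝ)⁻¹ with hr
  have hnr : Tendsto (fun n : ℕ => √(n : ℝ) * r n) atTop (𝓝 0) := by
    have h1 := hns.add hinv
    rw [add_zero] at h1
    refine h1.congr' ?_
    filter_upwards [eventually_gt_atTop 0] with n hn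
    have hn' : (0 : ℝ) < √(n : ℝ) := Real.sqrt_pos.2 (by exact_mod_cast hn)
    have h2 : (n : ℝ) = √(n : ℝ) * √(n : ℝ) := (Real.mul_self_sqrt (Nat.cast_nonneg n)).symm
    rw [hr, mul_add]
    congr 1
    nth_rewrite 3 [h2]
    field_simp
  have hr_tendsto : Tendsto r atTop (𝓝 0) := by
    have := hs_tendsto.add (tendsto_inv_atTop_zero.comp (tendsto_natCast_atTop_atTop (R := ℝ)))
    rwa [add_zero] at this
  -- In the cross term the factor `√n` cancels, so `r → 0` alone suffices there.
  have hsmall : Tendsto (fun n : ℕ => √(n : ℝ) * (2 * K / n + 72 * r n + 4 * √(8 * r n * K / n)))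
      atTop (𝓝 0) := by
    have h1 : Tendsto (fun n : ℕ => 2 * K * (√(n : ℝ))⁻¹ + 72 * (√(n : ℝ) * r n) +
        4 * √(8 * r n * K)) atTop (𝓝 (2 * K * 0 + 72 * 0 + 4 * √(8 * 0 * K))) :=
      ((hinv.const_mul _).add (hnr.const_mul _)).add
        ((((hr_tendsto.const_mul 8).mul_const K).sqrt).const_mul 4)
    simp only [mul_zero, zero_mul, Real.sqrt_zero, add_zero] at h1
    refine h1.congr' ?_
    filter_upwards [eventually_gt_atTop 0] with n hn
    have hn' : (0 : ℝ) < √(n : ℝ) := Real.sqrt_pos.2 (by exact_mod_cast hn)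
    have h2 : (n : ℝ) = √(n : ℝ) ^ 2 := (Real.sq_sqrt (Nat.cast_nonneg n)).symm
    rw [Real.sqrt_div' _ (Nat.cast_nonneg n)]
    have h3 : 2 * K / (n : ℝ) = 2 * K / √(n : ℝ) ^ 2 := by rw [← h2]
    rw [h3]
    field_simp
  have hlarge : Tendsto (fun n : ℕ => 16 * (√(n : ℝ) * s n)) atTop (𝓝 0) := by
    simpa using hns.const_mul 16
  filter_upwards [eventually_gt_atTop 3, hdev.eventually_lt_const (half_pos hε),
    hsmall.eventually_lt_const hη, hlarge.eventually_lt_const hη,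
    hr_tendsto.eventually_le_const (by norm_num : (0 : ℝ) < 1 / 32),
    hs_tendsto.eventually_le_const (by norm_num : (0 : ℝ) < 1 / 8),
    hs_tendsto.eventually_le_const (by linarith : 0 < (1 - B / A') / 4)]
    with n hn hdevn hsmalln hlargen hrn hsn hsn'
  have hn0 : 0 < n := by omega
  have hn' : (3 : ℝ) < n := by exact_mod_cast hn
  rw [dist_zero_right, Real.norm_eq_abs, abs_of_nonneg measureReal_nonneg]
  have hae : ∀ᵐ g ∂(stdPi n), IsScaledLasso (X n) (X n *ᵥ β n + σ n • g)
      (penaltyLevel A n (p n)) (bhat n (X n *ᵥ β n + σ n • g))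
      (shat n (X n *ᵥ β n + σ n • g)) := by
    have := hlasso n
    rw [pr_eq_map_stdPi] at this
    exact ae_of_ae_map (by fun_prop) this
  suffices hbad : ∃ S : Set (Fin n → ℝ), (stdPi n).real S ≤ ε / 4 ∧ ∀ g, g ∉ S →
      IsScaledLasso (X n) (X n *ᵥ β n + σ n • g) (penaltyLevel A n (p n))
        (bhat n (X n *ᵥ β n + σ n • g)) (shat n (X n *ᵥ β n + σ n • g)) →
      |∑ i, g i ^ 2 - (n : ℝ)| < 3 / 4 * n →
      √(n : ℝ) * |shat n (X n *ᵥ β n + σ n • g) -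
        sigmaStar (X n) (X n *ᵥ β n + σ n • g) (β n)| < η * σ n by
    obtain ⟨S, hS, hg⟩ := hbad
    have hsub : (stdPi n).real {g | η * σ n ≤ √(n : ℝ) *
        |shat n (X n *ᵥ β n + σ n • g) - sigmaStar (X n) (X n *ᵥ β n + σ n • g) (β n)|} ≤
        (stdPi n).real ({g | 3 / 4 * (n : ℝ) ≤ |∑ i, g i ^ 2 - n|} ∪ S) := by
      refine ENNReal.toReal_mono (measure_ne_top _ _) (measure_mono_ae ?_)
      filter_upwards [hae] with g hlg hgη
      by_contra hcon
      obtain ⟨h1, h2⟩ := not_or.1 hcon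
      exact not_le.2 (hg g h2 hlg (not_le.1 h1)) hgη
    have := measureReal_union_le (μ := stdPi n) {g | 3 / 4 * (n : ℝ) ≤ |∑ i, g i ^ 2 - n|} S
    linarith
  -- The regime is chosen separately for each `n`, so `p` need not converge or diverge.
  rcases le_or_gt M (p n) with hpM | hpM
  · obtain ⟨hL, hsmallp⟩ := hM (p n) hpM
    refine ⟨_, (stdPi_zStar_gt_le hn (hX n) (β n) (hσ n) hL).trans ?_, ?_⟩
    · have h1 : √((n : ℝ) / (n - 3)) ≤ 2 := by
        refine Real.sqrt_le_iff.2 ⟨two_pos.le, ?_⟩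
        have h4 : (4 : ℝ) ≤ n := by exact_mod_cast hn
        rw [div_le_iff₀ (by linarith)]
        linarith
      have h2 : 1 ≤ √(Real.pi * (B ^ 2 * Real.log (p n))) := by
        refine Real.one_le_sqrt.2 ?_
        nlinarith [Real.pi_gt_three]
      calc (p n : ℝ) * (√((n : ℝ) / (n - 3)) * Real.exp (-(B ^ 2 * Real.log (p n))) /
            √(Real.pi * (B ^ 2 * Real.log (p n))))
          ≤ (p n : ℝ) * (2 * Real.exp (-(B ^ 2 * Real.log (p n))) / 1) := by gcongr
        _ ≤ ε / 4 := by rw [div_one]; linarith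
    · intro g hg hl hd
      have hz := not_not.1 hg
      obtain ⟨hlow, hupp⟩ := sigmaStar_mem_of_abs_lt hn0 (X n) (β n) (hσ n) hd
      have hp1 : (1 : ℝ) < p n := by
        have : 1 < p n := by omega
        exact_mod_cast this
      have hlam0 : 0 < penaltyLevel A n (p n) :=
        mul_pos hA0 (Real.sqrt_pos.2 (mul_pos (by positivity) (Real.log_pos hp1)))
      rw [sqrt_two_mul_div_eq hA hξ _ (by linarith)] at hz
      have hfin := hl.abs_sub_sigmaStar_le hlam0 hξ (hσ n) hlow hupp (s := s n) rfl
        (ρ := B / A') (by linarith) (by linarith) hz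
      calc √(n : ℝ) * |shat n (X n *ᵥ β n + σ n • g) -
            sigmaStar (X n) (X n *ᵥ β n + σ n • g) (β n)|
          ≤ √(n : ℝ) * (16 * s n * σ n) := by gcongr
        _ = 16 * (√(n : ℝ) * s n) * σ n := by ring
        _ < η * σ n := mul_lt_mul_of_pos_right hlargen (hσ n)
  · obtain ⟨d, hd, v, hv, hW⟩ := exists_energy (X n)
    refine ⟨_, (stdPi_real_energy_gt_le (hd.trans hpM.le) hv hc0).trans ?_, ?_⟩
    · rw [hc2]
      apply le_of_eq
      field_simp
    · intro g hg hl hdv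
      have hgK : ∑ k, (v k ⬝ᵥ g) ^ 2 ≤ K := not_lt.1 hg
      obtain ⟨hlow, hupp⟩ := sigmaStar_mem_of_abs_lt hn0 (X n) (β n) (hσ n) hdv
      have hr0 : 0 ≤ r n := add_nonneg (hs0 n) (by positivity)
      have hfin := hl.abs_sub_sigmaStar_le_of_energy hn0 (hlam n) hξ (hσ n) hlow hupp hK0 hr0
        (lt_add_of_pos_right (s n) (by positivity)) (by linarith) (fun u => by
          rw [add_sub_cancel_left, smul_dotProduct, smul_eq_mul, mul_pow]
          calc σ n ^ 2 * (g ⬝ᵥ (X n *ᵥ u)) ^ 2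
              ≤ σ n ^ 2 * (l2 (X n *ᵥ u) ^ 2 * K) := by
                gcongr
                exact (hW u g).trans (by gcongr)
            _ = _ := by ring)
      calc √(n : ℝ) * |shat n (X n *ᵥ β n + σ n • g) -
            sigmaStar (X n) (X n *ᵥ β n + σ n • g) (β n)|
          ≤ √(n : ℝ) * (σ n * (2 * K / n + 72 * r n + 4 * √(8 * r n * K / n))) := by gcongr
        _ = √(n : ℝ) * (2 * K / n + 72 * r n + 4 * √(8 * r n * K / n)) * σ n := by ring
        _ < η * σ n := mul_lt_mul_of_pos_right hsmalln (hσ n)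

end Consistency

end ScaledLasso

namespace ScaledLasso

/-! ### The central limit theorem, with all `n` coupled through one infinite noise sequence. -/

section AsymptoticNormality

/-- The law of an infinite sequence of independent standard Gaussian variables. -/
noncomputable abbrev stdSeq : Measure (ℕ → ℝ) := Measure.infinitePi fun _ => gaussianReal 0 1

lemma measurable_restrict_fin (n : ℕ) : Measurable fun (ω : ℕ → ℝ) (i : Fin n) => ω i :=
  measurable_pi_lambda _ fun i => measurable_pi_apply (i : ℕ)

lemma stdSeq_map_fin (n : ℕ) : stdSeq.map (fun ω (i : Fin n) => ω i) = stdPi n := by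
  have := Measure.map_infinitePi_infinitePi_of_inj (P := fun _ : ℕ => gaussianReal 0 1)
    (Fin.val_injective (n := n))
  exact this.trans (Measure.infinitePi_eq_pi (μ := fun _ : Fin n => gaussianReal 0 1))

lemma stdSeq_real_preimage_le (n : ℕ) (S : Set (Fin n → ℝ)) :
    stdSeq.real ((fun ω (i : Fin n) => ω i) ⁻¹' S) ≤ (stdPi n).real S := by
  rw [← stdSeq_map_fin n]
  refine ENNReal.toReal_mono ?_ (Measure.le_map_apply (measurable_restrict_fin n).aemeasurable S)
  rw [stdSeq_map_fin n]
  exact measure_ne_top _ _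

/-- Convergence in distribution depends only on the laws; this carries the limit from the coupled
space back to the measures `pr`, which live on different spaces. -/
lemma tendstoInDistribution_of_map_eq {ι Ω Ω' Ω'' : Type*} {E : ι → Type*}
    {mE : ∀ i, MeasurableSpace (E i)} [MeasurableSpace Ω] [MeasurableSpace Ω'] [MeasurableSpace Ω'']
    {P : Measure Ω} [IsProbabilityMeasure P] {μ' : Measure Ω'} [IsProbabilityMeasure μ']
    {μ'' : Measure Ω''} [IsProbabilityMeasure μ''] {μ : ∀ i, Measure (E i)}
    [∀ i, IsProbabilityMeasure (μ i)] {l : Filter ι} {Y : ι → Ω → ℝ} {Z : Ω' → ℝ} {Z' : Ω'' → ℝ}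
    {f : ∀ i, E i → ℝ} (h : TendstoInDistribution Y l Z (fun _ => P) μ')
    (hf : ∀ i, AEMeasurable (f i) (μ i)) (hZ' : AEMeasurable Z' μ'')
    (hfY : ∀ i, (μ i).map (f i) = P.map (Y i)) (hZ : μ''.map Z' = μ'.map Z) :
    TendstoInDistribution f l Z' μ μ'' where
  forall_aemeasurable := hf
  aemeasurable_limit := hZ'
  tendsto := by
    have e1 : (fun i => (⟨(μ i).map (f i), Measure.isProbabilityMeasure_map (hf i)⟩ :
        ProbabilityMeasure ℝ)) =
        fun i => ⟨P.map (Y i), Measure.isProbabilityMeasure_map (h.forall_aemeasurable i)⟩ :=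
      funext fun i => Subtype.ext (hfY i)
    have e2 : (⟨μ''.map Z', Measure.isProbabilityMeasure_map hZ'⟩ : ProbabilityMeasure ℝ) =
        ⟨μ'.map Z, Measure.isProbabilityMeasure_map h.aemeasurable_limit⟩ := Subtype.ext hZ
    rw [e1, e2]
    exact h.tendsto

/-- The central limit theorem for the chi-square distribution. -/
lemma tendstoInDistribution_sum_sq :
    TendstoInDistribution
      (fun (n : ℕ) (ω : ℕ → ℝ) => ((√(n : ℝ))⁻¹ * (∑ i : Fin n, ω i ^ 2 - n)) / 2) atTop
      (fun x : ℝ => x / 2) (fun _ => stdSeq) (gaussianReal 0 2) := by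
  have hmp : ∀ i : ℕ, MeasurePreserving (Function.eval i) stdSeq (gaussianReal 0 1) := fun i =>
    measurePreserving_eval_infinitePi (fun _ : ℕ => gaussianReal 0 1) i
  have hmean : ∫ ω, ω 0 ^ 2 ∂stdSeq = 1 := by
    have h1 := integral_map (μ := stdSeq) (φ := Function.eval 0) (f := fun x : ℝ => x ^ 2)
      (hmp 0).measurable.aemeasurable (by fun_prop)
    rw [(hmp 0).map_eq, integral_sq_gaussianReal] at h1
    exact h1.symm
  have hvar : Var[fun ω => ω 0 ^ 2; stdSeq] = 2 := by
    rw [← variance_sq_gaussianReal, ← (hmp 0).map_eq,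
      variance_map (by fun_prop) (hmp 0).measurable.aemeasurable]
    rfl
  have hind : iIndepFun (fun (i : ℕ) (ω : ℕ → ℝ) => ω i ^ 2) stdSeq :=
    iIndepFun_infinitePi (X := fun _ x => x ^ 2) (fun _ => by fun_prop)
  have hident : ∀ i : ℕ, IdentDistrib (fun ω : ℕ → ℝ => ω i ^ 2) (fun ω => ω 0 ^ 2) stdSeq stdSeq :=
    fun i => by
      have : IdentDistrib (Function.eval i : (ℕ → ℝ) → ℝ) (Function.eval 0) stdSeq stdSeq :=
        ⟨(hmp i).measurable.aemeasurable, (hmp 0).measurable.aemeasurable, by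
          rw [(hmp i).map_eq, (hmp 0).map_eq]⟩
      exact this.comp (u := fun x : ℝ => x ^ 2) (by fun_prop)
  have hL2 : MemLp (fun ω : ℕ → ℝ => ω 0 ^ 2) 2 stdSeq :=
    memLp_sq_gaussianReal.comp_measurePreserving (hmp 0)
  have hlaw : HasLaw (id : ℝ → ℝ)
      (gaussianReal 0 Var[fun ω : ℕ → ℝ => ω 0 ^ 2; stdSeq].toNNReal) (gaussianReal 0 2) := by
    rw [hvar]
    refine ⟨by fun_prop, ?_⟩
    rw [Measure.map_id]
    congr 1
    simp
  have hclt : TendstoInDistribution (fun (n : ℕ) (ω : ℕ → ℝ) => (√(n : ℝ))⁻¹ *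
      (∑ k ∈ Finset.range n, ω k ^ 2 - n * ∫ ω : ℕ → ℝ, ω 0 ^ 2 ∂stdSeq)) atTop (id : ℝ → ℝ)
      (fun _ => stdSeq) (gaussianReal 0 2) :=
    tendstoInDistribution_inv_sqrt_mul_sum_sub (X := fun (i : ℕ) (ω : ℕ → ℝ) => ω i ^ 2)
      (P := stdSeq) hlaw hL2 hind hident
  have hdiv := hclt.continuous_comp (g := fun x : ℝ => x / 2) (by fun_prop)
  simp only [hmean, mul_one] at hdiv
  have e : (fun (n : ℕ) (ω : ℕ → ℝ) => ((√(n : ℝ))⁻¹ * (∑ i : Fin n, ω i ^ 2 - n)) / 2) =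
      fun n : ℕ => (fun x : ℝ => x / 2) ∘
        fun ω : ℕ → ℝ => (√(n : ℝ))⁻¹ * (∑ k ∈ Finset.range n, ω k ^ 2 - (n : ℝ)) := by
    funext n ω
    simp only [Function.comp_apply, Finset.sum_range]
  rw [e]
  exact hdiv

/-- The delta method for the square root with explicit quadratic remainder: with `u = √N` and `w =
√Q` the error is exactly `(w - u)² / (2 u)`, and `(w² - u²)² ≥ (w - u)² u²`. -/
lemma abs_sqrt_sub_linear_le {Q N : ℝ} (hN : 0 < N) (hQ : 0 ≤ Q) :
    |√N * (√Q / √N - 1) - (√N)⁻¹ * (Q - N) / 2| ≤ (Q - N) ^ 2 / (2 * (N * √N)) := by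
  have hsN : 0 < √N := Real.sqrt_pos.2 hN
  have hsQ : 0 ≤ √Q := Real.sqrt_nonneg Q
  have h1 : √N ^ 2 = N := Real.sq_sqrt hN.le
  have h2 : √Q ^ 2 = Q := Real.sq_sqrt hQ
  generalize √N = u at *
  generalize √Q = w at *
  subst h1 h2
  have e1 : u * (w / u - 1) - u⁻¹ * (w ^ 2 - u ^ 2) / 2 = -((w - u) ^ 2 / (2 * u)) := by
    field_simp
    ring
  rw [e1, abs_neg, abs_of_nonneg (by positivity), div_le_div_iff₀ (by positivity) (by positivity)]
  have e2 : (w ^ 2 - u ^ 2) ^ 2 * (2 * u) - (w - u) ^ 2 * (2 * (u ^ 2 * u)) =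
      2 * u * (w - u) ^ 2 * (w * (w + 2 * u)) := by ring
  have : 0 ≤ 2 * u * (w - u) ^ 2 * (w * (w + 2 * u)) := by positivity
  linarith

variable {A ξ : ℝ} {p : ℕ → ℕ} {X : ∀ n, Matrix (Fin n) (Fin (p n)) ℝ}
  {β : ∀ n, Fin (p n) → ℝ} {σ : ℕ → ℝ}
  {bhat : ∀ n, (Fin n → ℝ) → (Fin (p n) → ℝ)} {shat : ∀ n, (Fin n → ℝ) → ℝ}

/-- Slutsky's argument: the difference from the linearized chi-square variable splits into `shat -
sigmaStar` and the remainder of the square root, each given `ε / 2`. -/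
theorem tendstoInDistribution_shat (hξ : 1 < ξ) (hA : (ξ + 1) / (ξ - 1) < A)
    (hσ : ∀ n, 0 < σ n) (hX : ∀ n, ColumnsNormalized (X n))
    (hmeas : ∀ n, AEMeasurable (shat n) (pr (X n) (β n) (σ n)))
    (hlasso : ∀ n, ∀ᵐ y ∂(pr (X n) (β n) (σ n)),
      IsScaledLasso (X n) y (penaltyLevel A n (p n)) (bhat n y) (shat n y))
    (hrate : (fun n => penaltyLevel A n (p n) *
        mu (X n) (β n) (σ n * penaltyLevel A n (p n)) ξ / σ n)
      =o[atTop] fun n : ℕ => (n : ℝ) ^ (-(1 / 2) : ℝ)) :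
    TendstoInDistribution
      (fun (n : ℕ) (y : Fin n → ℝ) => √(n : ℝ) * (shat n y / σ n - 1)) atTop
      (id : ℝ → ℝ) (fun n => pr (X n) (β n) (σ n)) (gaussianReal 0 (1 / 2)) := by
  set H : ∀ n, (ℕ → ℝ) → (Fin n → ℝ) := fun n ω => X n *ᵥ β n + σ n • fun i : Fin n => ω i with hH
  have hHm : ∀ n, Measurable (H n) := fun n =>
    measurable_const.add ((measurable_restrict_fin n).const_smul (σ n))
  have hHmap : ∀ n, stdSeq.map (H n) = pr (X n) (β n) (σ n) := fun n => by
    rw [pr_eq_map_stdPi, ← stdSeq_map_fin n, Measure.map_map (by fun_prop) (measurable_restrict_fin n)]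
    rfl
  set V : ℕ → (ℕ → ℝ) → ℝ := fun n ω => √(n : ℝ) * (shat n (H n ω) / σ n - 1) with hV
  have hfm : ∀ n, AEMeasurable (fun y : Fin n → ℝ => √(n : ℝ) * (shat n y / σ n - 1))
      (pr (X n) (β n) (σ n)) := fun n => (((hmeas n).div_const _).sub_const _).const_mul _
  have hfm' : ∀ n, AEMeasurable (fun y : Fin n → ℝ => √(n : ℝ) * (shat n y / σ n - 1))
      (stdSeq.map (H n)) := fun n => by rw [hHmap]; exact hfm n
  have hVm : ∀ n, AEMeasurable (V n) stdSeq := fun n => (hfm' n).comp_measurable (hHm n)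
  have hlim : TendstoInDistribution V atTop (fun x : ℝ => x / 2) (fun _ => stdSeq)
      (gaussianReal 0 2) := by
    refine tendstoInDistribution_of_tendstoInMeasure_sub V _ tendstoInDistribution_sum_sq ?_ hVm
    rw [tendstoInMeasure_iff_measureReal_norm]
    intro ε hε
    have h1 := tendsto_stdPi_abs_shat_sub_sigmaStar_ge hξ hA hσ hX hlasso hrate (half_pos hε)
    have h2 : Tendsto (fun n : ℕ => 2 / ε * (√(n : ℝ))⁻¹) atTop (𝓝 (2 / ε * 0)) :=
      (tendsto_inv_atTop_zero.comp
        (Real.tendsto_sqrt_atTop.comp tendsto_natCast_atTop_atTop)).const_mul _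
    rw [mul_zero] at h2
    have h3 := h1.add h2
    rw [add_zero] at h3
    refine squeeze_zero' (Eventually.of_forall fun n => measureReal_nonneg) ?_ h3
    filter_upwards [eventually_gt_atTop 0] with n hn
    have hn' : (0 : ℝ) < n := by exact_mod_cast hn
    have hsn : 0 < √(n : ℝ) := Real.sqrt_pos.2 hn'
    -- Deviations below `c` keep the remainder under `ε / 2`, while Chebyshev's bound `2 n / c²` is
    -- of order `n^{-1/2}`.
    set c : ℝ := √(ε * (n * √(n : ℝ))) with hc
    have hc0 : 0 < c := Real.sqrt_pos.2 (by positivity)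
    have hc2 : c ^ 2 = ε * (n * √(n : ℝ)) := Real.sq_sqrt (by positivity)
    have hcheb := stdPi_real_sum_sq_sub_ge_le n hc0
    have hcheb' : 2 * (n : ℝ) / c ^ 2 = 2 / ε * (√(n : ℝ))⁻¹ := by
      rw [hc2]; field_simp
    rw [hcheb'] at hcheb
    refine le_trans ?_ (add_le_add le_rfl hcheb)
    refine le_trans ?_ (measureReal_union_le _ _)
    refine le_trans ?_ (stdSeq_real_preimage_le n _)
    refine measureReal_mono fun ω hω => ?_
    by_contra hcon
    obtain ⟨hn1, hn2⟩ := not_or.1 hcon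
    have hn1' : √(n : ℝ) * |shat n (H n ω) - sigmaStar (X n) (H n ω) (β n)| < ε / 2 * σ n :=
      not_le.1 hn1
    have hn2' : |∑ i : Fin n, ω i ^ 2 - (n : ℝ)| < c := not_le.1 hn2
    have hω' : ε ≤ |V n ω - ((√(n : ℝ))⁻¹ * (∑ i : Fin n, ω i ^ 2 - n)) / 2| := by
      simpa using hω
    refine absurd hω' (not_le.2 ?_)
    set Q : ℝ := ∑ i : Fin n, ω i ^ 2 with hQ
    have hQ0 : 0 ≤ Q := Finset.sum_nonneg fun _ _ => sq_nonneg _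
    have hlin := abs_sqrt_sub_linear_le hn' hQ0
    have hstar : sigmaStar (X n) (H n ω) (β n) = σ n * (√Q / √n) :=
      sigmaStar_add_smul (β n) (hσ n) _
    have hlin' : (Q - n) ^ 2 / (2 * (n * √(n : ℝ))) < ε / 2 := by
      rw [div_lt_iff₀ (by positivity)]
      have : (Q - n) ^ 2 < c ^ 2 := sq_lt_sq' (abs_lt.1 hn2').1 (abs_lt.1 hn2').2
      rw [hc2] at this
      linarith
    have hmain : |V n ω - √(n : ℝ) * (√Q / √n - 1)| < ε / 2 := by
      have e1 : V n ω - √(n : ℝ) * (√Q / √n - 1) =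
          √(n : ℝ) * (shat n (H n ω) - sigmaStar (X n) (H n ω) (β n)) / σ n := by
        rw [hstar, hV]
        have := (hσ n).ne'
        field_simp
        ring
      rw [e1, abs_div, abs_mul, abs_of_pos hsn, abs_of_pos (hσ n), div_lt_iff₀ (hσ n)]
      exact hn1'
    calc |V n ω - (√(n : ℝ))⁻¹ * (Q - n) / 2|
        ≤ |V n ω - √(n : ℝ) * (√Q / √n - 1)| +
          |√(n : ℝ) * (√Q / √n - 1) - (√(n : ℝ))⁻¹ * (Q - n) / 2| := abs_sub_le _ _ _
      _ < ε := by linarith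
  refine tendstoInDistribution_of_map_eq hlim hfm aemeasurable_id (fun n => ?_) ?_
  · rw [← hHmap n, AEMeasurable.map_map_of_aemeasurable (hfm' n)
      (hHm n).aemeasurable]
    rfl
  · rw [Measure.map_id, gaussianReal_map_div_const, zero_div]
    congr 1
    ext
    norm_num

end AsymptoticNormality

end ScaledLasso

open ScaledLasso in
theorem theorem2 :
    -- (i) the deterministic oracle inequalities
    (∀ (n p : ℕ) (X : Matrix (Fin n) (Fin p) ℝ) (y : Fin n → ℝ) (β : Fin p → ℝ)
        (lam0 ξ : ℝ) (bhat : Fin p → ℝ) (shat : ℝ),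
        0 < lam0 → 1 < ξ → 0 < sigmaStar X y β →
        IsScaledLasso X y lam0 bhat shat →
        GoodEvent X y β lam0 ξ →
        max (1 - shat / sigmaStar X y β) (1 - sigmaStar X y β / shat)
            ≤ tauStar X y β lam0 ξ ^ 2 ∧
          (tauStar X y β lam0 ξ ^ 2 < 1 →
            0 < shat ∧
            l1 (bhat - β) ≤
              mu X β (sigmaStar X y β * lam0) ξ / (1 - tauStar X y β lam0 ξ ^ 2))) ∧
    -- (ii) the probability bound; the `o(1)` is uniform as `log (p / ε) → ∞`
    (∀ δ : ℝ, 0 < δ → ∃ L : ℝ, 0 < L ∧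
        ∀ (n p : ℕ) (X : Matrix (Fin n) (Fin p) ℝ) (β : Fin p → ℝ) (σ lam0 ξ ε : ℝ),
          0 < σ → 1 < ξ → 0 < ε → ColumnsNormalized X →
          L ≤ Real.log (p / ε) → Real.log (p / ε) < (n : ℝ) - 2 →
          (1 - (1 + δ) * ε / √(Real.pi * Real.log (p / ε)) ≤
            (pr X β σ).real {y | PenaltyCondition X y β lam0 ξ ε → GoodEvent X y β lam0 ξ}) ∧
          ((∀ᵐ y ∂(pr X β σ), PenaltyCondition X y β lam0 ξ ε) →
            1 - (1 + δ) * ε / √(Real.pi * Real.log (p / ε)) ≤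
              (pr X β σ).real {y | GoodEvent X y β lam0 ξ})) ∧
    -- (ii) asymptotic normality of the noise level estimator
    (∀ (A ξ : ℝ) (p : ℕ → ℕ) (X : ∀ n, Matrix (Fin n) (Fin (p n)) ℝ)
        (β : ∀ n, Fin (p n) → ℝ) (σ : ℕ → ℝ)
        (bhat : ∀ n, (Fin n → ℝ) → (Fin (p n) → ℝ)) (shat : ∀ n, (Fin n → ℝ) → ℝ),
        1 < ξ → (ξ + 1) / (ξ - 1) < A →
        (∀ n, 0 < σ n) → (∀ n, ColumnsNormalized (X n)) →
        (∀ n, AEMeasurable (shat n) (pr (X n) (β n) (σ n))) →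
        (∀ n, ∀ᵐ y ∂(pr (X n) (β n) (σ n)),
          IsScaledLasso (X n) y (penaltyLevel A n (p n)) (bhat n y) (shat n y)) →
        ((fun n => penaltyLevel A n (p n) *
            mu (X n) (β n) (σ n * penaltyLevel A n (p n)) ξ / σ n)
          =o[atTop] fun n : ℕ => (n : ℝ) ^ (-(1 / 2) : ℝ)) →
        TendstoInDistribution
          (fun (n : ℕ) (y : Fin n → ℝ) => √(n : ℝ) * (shat n y / σ n - 1)) atTop
          (id : ℝ → ℝ) (fun n => pr (X n) (β n) (σ n)) (gaussianReal 0 (1 / 2))) := by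
  refine ⟨?_, fun δ hδ => uniform_probability_bound hδ, ?_⟩
  · intro n p X y β lam0 ξ bhat shat hlam0 hξ hσ h hg
    exact h.oracle_inequality hlam0 hξ hσ hg
  · intro A ξ p X β σ bhat shat hξ hA hσ hX hmeas hlasso hrate
    exact tendstoInDistribution_shat hξ hA hσ hX hmeas hlasso hrate
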